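/- **Setting.** For $k\in\mathbb Z$ let $S_k$ be the set of sequences $\{\alpha\}_k=(\alpha_i)_{i\le k}$ in $\mathbb N_0$ with $\alpha_i=0$ for all sufficiently negative $i$, let $S=\bigcup_k S_k$, and let $B:S\to\{2,3,4,\dots\}$, written $B_{\{\alpha\}_k}$. Let $\mathbb S_B$ be the set of sequences $\alpha=(\alpha_i)_{i\in\mathbb Z}$ in $\mathbb N_0$ that vanish for all sufficiently negative $i$ and satisfy $0\le\alpha_{k+1}\le B_{\{\alpha\}_k}-1$ for all $k\in\mathbb Z$, where $\{\alpha\}_k=(\alpha_i)_{i\le k}$. Fix $q>1$ and equip $\mathbb S_B$ with the metric $\rho(\alpha,\alpha)=0$, $\rho(\alpha,\beta)=q^{-i_0}$ for $\alpha\ne\beta$, with $i_0$ the first index at which $\alpha$ and $\beta$ differ, and with its Borel $\sigma$-algebra. The ball $K(\alpha,q^N)=\{\beta:\rho(\alpha,\beta)\le q^N\}$, $N\in\mathbb Z$, is determined by $\{\alpha\}_{-(N+1)}$. Let $a:\mathbb Z\to\mathbb R$ satisfy $a(N)\ge a(N+1)$, $\lim_{N\to\infty}a(N)=0$ and $\lim_{N\to-\infty}a(N)=W$,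 where $W$ is a positive real number or $+\infty$. For $M\in\mathbb Z$ and $m\ge1$ put $$B(\alpha,m,M)=(B_{\{\alpha\}_{-(M+m+1)}}-1)\,B_{\{\alpha\}_{-(M+m)}}\cdots B_{\{\alpha\}_{-(M+2)}},\qquad u(\alpha,m,M)=\frac{a(M+m-1)-a(M+m)}{B(\alpha,m,M)},$$ $$E(\alpha,N,t)=\exp\{-(a(N)+u(\alpha,1,N))\,t\},$$ $$Q(\alpha,M,t)=\sum_{n=0}^\infty\big(B_{\{\alpha\}_{-(M+n+2)}}\cdots B_{\{\alpha\}_{-(M+2)}}\big)^{-1}\big(B_{\{\alpha\}_{-(M+n+2)}}-1\big)\,E(\alpha,M+n,t).$$ For $t>0$ set $P(\alpha,K(\beta,q^M),t)=Q(\alpha,M,t)$ if $\rho(\alpha,\beta)\le q^M$, and $$P(\alpha,K(\beta,q^M),t)=B(\beta,k,M)^{-1}\,B_{\{\alpha\}_{-(M+k+1)}}^{-1}\big(B_{\{\alpha\}_{-(M+k+1)}}-1\big)\big[Q(\alpha,M+k,t)-E(\alpha,M+k-1,t)\big]$$ if $\rho(\alpha,\beta)=q^{M+k}$ with $k\ge1$.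 **Proposition 4.1.** There is exactly one Borel measure $\mu$ on $\mathbb S_B$ with $\mu(K(0,q^0))=1$ and $\mu(K(\alpha,q^M))=B_{\{\alpha\}_{-(M+1)}}\,\mu(K(\alpha,q^{M-1}))$ for all $\alpha\in\mathbb S_B$, $M\in\mathbb Z$. For all $\eta\in\mathbb S_B$ and $t>0$ the numbers $P(\eta,K(\beta,q^M),t)$ are non-negative and are the values on balls of exactly one Borel measure $A\mapsto P(\eta,A,t)$ on $\mathbb S_B$, and $\eta\mapsto P(\eta,A,t)$ is Borel measurable for every Borel set $A$. Moreover: (i) $P$ is $\mu$-symmetric: for all $t>0$ and all Borel functions $u,v:\mathbb S_B\to[0,\infty]$, $$\int_{\mathbb S_B}u(\eta)\Big(\int_{\mathbb S_B}v(\xi)\,P(\eta,d\xi,t)\Big)\mu(d\eta)=\int_{\mathbb S_B}\Big(\int_{\mathbb S_B}u(\eta)\,P(\xi,d\eta,t)\Big)v(\xi)\,\mu(d\xi)\le\infty .$$ (ii) $P(\eta,\mathbb S_B,t)=1$ for all $\eta\in\mathbb S_B$ and $t>0$. (iii) With $p_tu(\eta)=\int_{\mathbb S_B}P(\eta,d\xi,t)\,u(\xi)$,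 one has $p_t(p_su)(\eta)=p_{t+s}u(\eta)$ for all $t,s>0$, all $\eta\in\mathbb S_B$ and every bounded Borel function $u:\mathbb S_B\to\mathbb R$. -/

import Mathlib

open Filter Topology MeasureTheory
open scoped ENNReal

noncomputable section

/-- The set `S_k` of one-sided sequences `{α}_k = (α_i)_{i ≤ k}` of non-negative integers which
vanish for all sufficiently negative indices. -/
def OneSidedSeq (k : ℤ) : Type :=
  {x : Set.Iic k → ℕ // ∃ N : ℤ, N ≤ k ∧ ∀ i : Set.Iic k, (i : ℤ) ≤ N → x i = 0}

/-- A function `B` on `S = ⋃ k, S_k` (a disjoint union) with values in `{2, 3, 4, …}`. -/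
structure Branching where
  /-- the value `B_{{α}_k}` -/
  toFun : (k : ℤ) → OneSidedSeq k → ℕ
  two_le : ∀ (k : ℤ) (x : OneSidedSeq k), 2 ≤ toFun k x

/-- The truncation `{α}_k` of a two-sided sequence `α` that vanishes near `-∞`. -/
def truncSeq (α : ℤ → ℕ) (h : ∃ N : ℤ, ∀ i ≤ N, α i = 0) (k : ℤ) : OneSidedSeq k :=
  ⟨fun i => α i, by
    obtain ⟨N, hN⟩ := h
    exact ⟨min N k, min_le_right _ _, fun i hi => hN _ (hi.trans (min_le_left _ _))⟩⟩

/-- The space `𝕊_B` of two-sided sequences all of whose truncations belong to `S_B`, i.e. are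
obtained from some zero sequence `{0}_N` by successive `B`-products: the sequence vanishes near
`-∞`, and `0 ≤ α_{k+1} ≤ B_{{α}_k} - 1` for every `k`. The set does not depend on the parameter
`q`, which only selects the metric `ρ_q` below. -/
@[ext] structure TreeSpace (B : Branching) (q : ℝ) where
  /-- the underlying sequence -/
  seq : ℤ → ℕ
  eventually_zero : ∃ N : ℤ, ∀ i ≤ N, seq i = 0
  admissible : ∀ k : ℤ, seq (k + 1) < B.toFun k (truncSeq seq eventually_zero k)

namespace TreeSpace

variable {B : Branching} {q : ℝ}

/-- The zero sequence. -/
instance : Zero (TreeSpace B q) where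
  zero :=
    { seq := fun _ => 0
      eventually_zero := ⟨0, fun _ _ => rfl⟩
      admissible := fun k => lt_of_lt_of_le Nat.zero_lt_two (B.two_le k _) }

/-- The branching number `B_{{α}_k}` of the truncation `{α}_k`. -/
def branch (α : TreeSpace B q) (k : ℤ) : ℕ :=
  B.toFun k (truncSeq α.seq α.eventually_zero k)

/-- The first index `i₀` at which `α` and `β` differ (used only for `α ≠ β`, when the set is
nonempty and bounded below). -/
def firstDiff (α β : TreeSpace B q) : ℤ := sInf {i : ℤ | α.seq i ≠ β.seq i}

open Classical in
/-- `ρ_q(α, α) = 0` and `ρ_q(α, β) = q ^ (-i₀)` for `α ≠ β`. -/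
def rho (α β : TreeSpace B q) : ℝ := if α = β then 0 else q ^ (-(firstDiff α β))

theorem diff_bddBelow (α β : TreeSpace B q) : BddBelow {i : ℤ | α.seq i ≠ β.seq i} := by
  obtain ⟨N, hN⟩ := α.eventually_zero
  obtain ⟨N', hN'⟩ := β.eventually_zero
  refine ⟨min N N', fun i hi => ?_⟩
  by_contra hlt
  push Not at hlt
  exact hi ((hN i (hlt.le.trans (min_le_left _ _))).trans
    (hN' i (hlt.le.trans (min_le_right _ _))).symm)

theorem firstDiff_mem {α β : TreeSpace B q} (h : α ≠ β) :
    α.seq (firstDiff α β) ≠ β.seq (firstDiff α β) := by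
  have hne : {i : ℤ | α.seq i ≠ β.seq i}.Nonempty := by
    by_contra hcon
    rw [Set.not_nonempty_iff_eq_empty] at hcon
    apply h
    ext i
    by_contra hi
    have hmem : i ∈ {i : ℤ | α.seq i ≠ β.seq i} := hi
    rw [hcon] at hmem
    exact hmem
  exact Int.csInf_mem hne (diff_bddBelow α β)

theorem firstDiff_le {α β : TreeSpace B q} {i : ℤ} (h : α.seq i ≠ β.seq i) :
    firstDiff α β ≤ i := csInf_le (diff_bddBelow α β) h

theorem rho_comm (α β : TreeSpace B q) : rho α β = rho β α := by
  have : firstDiff α β = firstDiff β α := by simp only [firstDiff, ne_comm]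
  by_cases h : α = β
  · rw [h]
  · simp [rho, this, h, Ne.symm h]

theorem rho_nonneg (hq : 1 < q) (α β : TreeSpace B q) : 0 ≤ rho α β := by
  unfold rho
  split_ifs
  · exact le_rfl
  · exact zpow_nonneg (by linarith) _

theorem rho_le_max (hq : 1 < q) (α β γ : TreeSpace B q) :
    rho α γ ≤ max (rho α β) (rho β γ) := by
  by_cases h : α = γ
  · have h0 : rho α γ = 0 := by simp [rho, h]
    rw [h0]
    exact le_max_of_le_left (rho_nonneg hq _ _)
  · have hm := firstDiff_mem h
    have hr : rho α γ = q ^ (-(firstDiff α γ)) := by simp [rho, h]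
    rw [hr]
    by_cases h1 : α.seq (firstDiff α γ) = β.seq (firstDiff α γ)
    · have h2 : β.seq (firstDiff α γ) ≠ γ.seq (firstDiff α γ) := h1 ▸ hm
      have h3 : β ≠ γ := fun hc => h2 (by rw [hc])
      refine le_max_of_le_right ?_
      have hr2 : rho β γ = q ^ (-(firstDiff β γ)) := by simp [rho, h3]
      rw [hr2]
      exact zpow_le_zpow_right₀ hq.le (neg_le_neg (firstDiff_le h2))
    · have h3 : α ≠ β := fun hc => h1 (by rw [hc])
      refine le_max_of_le_left ?_
      have hr2 : rho α β = q ^ (-(firstDiff α β)) := by simp [rho, h3]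
      rw [hr2]
      exact zpow_le_zpow_right₀ hq.le (neg_le_neg (firstDiff_le h1))

/-- `𝕊_B` with the metric `ρ_q`, `q > 1`. -/
instance [hq : Fact (1 < q)] : MetricSpace (TreeSpace B q) where
  dist := rho
  dist_self α := by simp [rho]
  dist_comm := rho_comm
  dist_triangle α β γ :=
    (rho_le_max hq.out α β γ).trans
      (max_le_add_of_nonneg (rho_nonneg hq.out _ _) (rho_nonneg hq.out _ _))
  eq_of_dist_eq_zero {α β} h := by
    by_contra hne
    have hr : rho α β = q ^ (-(firstDiff α β)) := by simp [rho, hne]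
    have hpos : (0 : ℝ) < q ^ (-(firstDiff α β)) := zpow_pos (by linarith [hq.out]) _
    have h' : rho α β = 0 := h
    linarith

instance [Fact (1 < q)] : MeasurableSpace (TreeSpace B q) := borel _

instance [Fact (1 < q)] : BorelSpace (TreeSpace B q) := ⟨rfl⟩

/-- The ball `K(α, q^N) = {β | ρ(α, β) ≤ q^N}`, which is identified with `{α}_{-(N+1)}`. -/
def ball [Fact (1 < q)] (α : TreeSpace B q) (N : ℤ) : Set (TreeSpace B q) :=
  Metric.closedBall α (q ^ N)

/-- The Borel measure generated (by the metric Carathéodory construction) by a set function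
defined on balls: `m α N` is the prescribed value on the ball `K(α, q^N)`. The sets used in the
coverings are the balls only, since every other set gets the value `∞`. -/
def measureOfBalls [Fact (1 < q)] (m : TreeSpace B q → ℤ → ℝ≥0∞) : Measure (TreeSpace B q) :=
  Measure.mkMetric' fun s => ⨅ (α : TreeSpace B q) (N : ℤ) (_ : s = ball α N), m α N

/-- The value of the reference measure on the ball `K(α, q^M)`. It is normalised by
`μ(K(0, q^0)) = 1`, and every ball splits into sub-balls of equal mass. Here `K(0, q^N)` is a ball
with `N ≥ 0`, `N ≥ M` that contains `α`. Its mass is the product of the branching numbers met on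
the way from `K(0, q^0)` up to it, and one divides by those met on the way down to `K(α, q^M)`. -/
def ballMass (α : TreeSpace B q) (M : ℤ) : ℝ≥0∞ :=
  let N : ℤ := max (max 0 M) (-(firstDiff α 0))
  (∏ l ∈ Finset.Ioc 0 N, ((0 : TreeSpace B q).branch (-(l + 1)) : ℝ≥0∞)) /
    ∏ l ∈ Finset.Ioc M N, (α.branch (-(l + 1)) : ℝ≥0∞)

variable (B q) in
/-- The reference measure `μ` on `𝕊_B`. -/
def mu [Fact (1 < q)] : Measure (TreeSpace B q) := measureOfBalls ballMass

/-- `B(α, m, M) = (B_{{α}_{-(M+m+1)}} - 1) B_{{α}_{-(M+m)}} ⋯ B_{{α}_{-(M+2)}}`, for `m ≥ 1`. -/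
def bigB (α : TreeSpace B q) (m : ℕ) (M : ℤ) : ℝ :=
  ((α.branch (-(M + m + 1)) : ℝ) - 1) * ∏ l ∈ Finset.Icc 2 m, (α.branch (-(M + l)) : ℝ)

/-- `u(α, m, M) = B(α, m, M)⁻¹ U(M + m)` with `U(N + 1) = a(N) - a(N + 1)`. -/
def rate (a : ℤ → ℝ) (α : TreeSpace B q) (m : ℕ) (M : ℤ) : ℝ :=
  (bigB α m M)⁻¹ * (a (M + m - 1) - a (M + m))

/-- The exponential `exp(-(a(N) + u(α, 1, N)) t)`. -/
def decay (a : ℤ → ℝ) (α : TreeSpace B q) (N : ℤ) (t : ℝ) : ℝ :=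
  Real.exp (-(a N + rate a α 1 N) * t)

/-- The probability of being at time `t` in the initial ball `K(α, q^M)`:
`∑_{n ≥ 0} (B_{{α}_{-(M+n+2)}} ⋯ B_{{α}_{-(M+2)}})⁻¹ (B_{{α}_{-(M+n+2)}} - 1)
  exp(-(a(M+n) + u(α, 1, M+n)) t)`. -/
def stayProb (a : ℤ → ℝ) (α : TreeSpace B q) (M : ℤ) (t : ℝ) : ℝ :=
  ∑' n : ℕ, (∏ l ∈ Finset.range (n + 1), (α.branch (-(M + l + 2)) : ℝ))⁻¹ *
    ((α.branch (-(M + n + 2)) : ℝ) - 1) * decay a α (M + n) t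

/-- The probability of a transition in time `t` from `K(α, q^M)` to the ball `K(β, q^M)` when
`ρ(α, β) = q^(M+k)`, `k ≥ 1`. -/
def jumpProb (a : ℤ → ℝ) (α β : TreeSpace B q) (k : ℕ) (M : ℤ) (t : ℝ) : ℝ :=
  (bigB β k M)⁻¹ * (α.branch (-(M + k + 1)) : ℝ)⁻¹ * ((α.branch (-(M + k + 1)) : ℝ) - 1) *
    (stayProb a α (M + k) t - decay a α (M + k - 1) t)

open Classical in
/-- The transition function `P(α, K(β, q^M), t)`. In the second case
`ρ(α, β) = q^(-i₀) = q^(M+k)` with `k = -i₀ - M ≥ 1`. -/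
def ballProb [Fact (1 < q)] (a : ℤ → ℝ) (t : ℝ) (α β : TreeSpace B q) (M : ℤ) : ℝ :=
  if dist α β ≤ q ^ M then stayProb a α M t
  else jumpProb a α β (-(firstDiff α β) - M).toNat M t

/-- The transition kernel `A ↦ P(η, A, t)`, as a Borel measure. -/
def transition [Fact (1 < q)] (a : ℤ → ℝ) (η : TreeSpace B q) (t : ℝ) :
    Measure (TreeSpace B q) :=
  measureOfBalls fun β M => ENNReal.ofReal (ballProb a t η β M)

/-- `p_t u (η) = ∫ P(η, dξ, t) u(ξ)`. -/
def semigroupOp [Fact (1 < q)] (a : ℤ → ℝ) (t : ℝ) (u : TreeSpace B q → ℝ)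
    (η : TreeSpace B q) : ℝ :=
  ∫ ξ, u ξ ∂(transition a η t)

end TreeSpace

end

/-! ### Balls as vertices of a tree -/

namespace TreeSpace

variable {B : Branching} {q : ℝ}

/-! Balls form a tree: two of them are nested or disjoint, and each splits into finitely many balls
of the next smaller radius, its children. They are a π-system generating the Borel sets, and
countably many of finite measure cover the space, which gives every uniqueness claim
(`measure_ext_of_ball`). Conversely, a set function on balls that is well defined and additive over
children extends to a measure (`IsBallContent.measureOfBalls_ball`). The upper bound comes from
splitting balls; the lower bound replaces compactness by the fact that nested balls have a common
point. Both `μ` and `P(η, ·, t)` arise in this way.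

The analysis of `P` rests on one recursion, `ballProb_eq`. With `b` the number of children of `K(β,
q^(M+1))`, it says that `1_{K(β, q^M)} - b⁻¹ 1_{K(β, q^(M+1))}` is an eigenfunction of `p_t` with
eigenvalue `E(β, M, t)`. Additivity over children, dependence on balls only, and detailed balance
follow by descending from balls that contain both points. For Chapman-Kolmogorov, `E(t + s) = E(t)
E(s)` makes the two sides differ by a bounded solution of `D(M) = b⁻¹ D(M+1)`; since `b ≥ 2`, it
vanishes.

Positivity and total mass one come from Jensen's inequality (`exp_le_stayProb`): the weights in
`Q(α, M, t)` have sum 1 and mean exponent `a(M)`, so `exp(-a(M) t) ≤ Q(α, M, t) ≤ 1`. Symmetry is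
invariance of `μ ⊗ P` under the swap, which need only be tested on products of balls of equal
radius. -/

theorem branch_congr {α β : TreeSpace B q} {k : ℤ} (h : ∀ i ≤ k, α.seq i = β.seq i) :
    α.branch k = β.branch k := by
  unfold branch
  congr 1
  exact Subtype.ext (funext fun i => h i i.2)

theorem two_le_branch (α : TreeSpace B q) (k : ℤ) : 2 ≤ α.branch k := B.two_le _ _

theorem le_firstDiff {α β : TreeSpace B q} (h : α ≠ β) {n : ℤ}
    (hn : ∀ i < n, α.seq i = β.seq i) : n ≤ firstDiff α β := by
  by_contra hlt
  exact firstDiff_mem h (hn _ (not_le.1 hlt))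

theorem seq_eq_of_lt_firstDiff {α β : TreeSpace B q} {i : ℤ} (h : i < firstDiff α β) :
    α.seq i = β.seq i := by
  by_contra hne
  exact absurd (firstDiff_le hne) (not_le.2 h)

theorem dist_eq [Fact (1 < q)] {α β : TreeSpace B q} (h : α ≠ β) :
    dist α β = q ^ (-(firstDiff α β)) := by
  change rho α β = _
  simp [rho, h]

theorem dist_le_zpow_iff [hq : Fact (1 < q)] {α β : TreeSpace B q} {N : ℤ} :
    dist α β ≤ q ^ N ↔ ∀ i < -N, α.seq i = β.seq i := by
  by_cases h : α = β
  · subst h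
    simpa using zpow_nonneg (by linarith [hq.out]) N
  · rw [dist_eq h, zpow_le_zpow_iff_right₀ hq.out]
    constructor
    · intro hle i hi
      exact seq_eq_of_lt_firstDiff (by omega)
    · intro hag
      have := le_firstDiff h hag
      omega

theorem mem_ball_iff [Fact (1 < q)] {α β : TreeSpace B q} {N : ℤ} :
    β ∈ ball α N ↔ ∀ i < -N, β.seq i = α.seq i := by
  rw [ball, Metric.mem_closedBall, dist_le_zpow_iff]

theorem mem_ball_self [Fact (1 < q)] (α : TreeSpace B q) (N : ℤ) : α ∈ ball α N :=
  mem_ball_iff.2 fun _ _ => rfl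

theorem mem_ball_comm [Fact (1 < q)] {α β : TreeSpace B q} {N : ℤ} :
    β ∈ ball α N ↔ α ∈ ball β N := by
  simp only [mem_ball_iff, eq_comm]

theorem ball_subset_of_mem [Fact (1 < q)] {α β : TreeSpace B q} {M N : ℤ} (h : β ∈ ball α N)
    (hMN : M ≤ N) : ball β M ⊆ ball α N := by
  intro γ hγ
  rw [mem_ball_iff] at *
  exact fun i hi => (hγ i (by omega)).trans (h i hi)

theorem ball_eq_of_mem [Fact (1 < q)] {α β : TreeSpace B q} {N : ℤ} (h : β ∈ ball α N) :
    ball β N = ball α N :=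
  (ball_subset_of_mem h le_rfl).antisymm (ball_subset_of_mem (mem_ball_comm.1 h) le_rfl)

theorem ball_mono [Fact (1 < q)] (α : TreeSpace B q) {M N : ℤ} (h : M ≤ N) :
    ball α M ⊆ ball α N := ball_subset_of_mem (mem_ball_self α N) h

theorem branch_eq_of_mem_ball [Fact (1 < q)] {α β : TreeSpace B q} {N k : ℤ}
    (h : β ∈ ball α N) (hk : k < -N) : β.branch k = α.branch k :=
  branch_congr fun i hi => mem_ball_iff.1 h i (by omega)

theorem isOpen_ball [hq : Fact (1 < q)] (α : TreeSpace B q) (N : ℤ) : IsOpen (ball α N) := by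
  rw [Metric.isOpen_iff]
  intro β hβ
  refine ⟨q ^ N, zpow_pos (by linarith [hq.out]) _, fun γ hγ => ?_⟩
  rw [← ball_eq_of_mem hβ]
  exact Metric.ball_subset_closedBall hγ

theorem measurableSet_ball [Fact (1 < q)] (α : TreeSpace B q) (N : ℤ) :
    MeasurableSet (ball α N) := (isOpen_ball α N).measurableSet

theorem exists_zpow_lt [hq : Fact (1 < q)] {ε : ℝ} (hε : 0 < ε) : ∃ n : ℕ, q ^ (-(n : ℤ)) < ε := by
  obtain ⟨n, hn⟩ := exists_pow_lt_of_lt_one hε (inv_lt_one_of_one_lt₀ hq.out)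
  exact ⟨n, by simpa [zpow_neg, inv_pow] using hn⟩

theorem exists_mem_ball [Fact (1 < q)] (α β : TreeSpace B q) (M : ℤ) :
    ∃ k : ℕ, β ∈ ball α (M + k) := by
  obtain ⟨N, hN⟩ := α.eventually_zero
  obtain ⟨N', hN'⟩ := β.eventually_zero
  refine ⟨(-(min N N') - M).toNat, mem_ball_iff.2 fun i hi => ?_⟩
  rw [hN i (by omega), hN' i (by omega)]

theorem iUnion_ball [Fact (1 < q)] (α : TreeSpace B q) : ⋃ n : ℕ, ball α n = Set.univ := by
  refine Set.eq_univ_of_forall fun β => Set.mem_iUnion.2 ?_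
  obtain ⟨k, hk⟩ := exists_mem_ball α β 0
  exact ⟨k, by simpa using hk⟩

/-- The point of `K(α, q^M)` with coordinate `j` at `-M` and zeros from then on. -/
def child (α : TreeSpace B q) (M : ℤ) (j : Fin (α.branch (-(M + 1)))) : TreeSpace B q where
  seq i := if i < -M then α.seq i else if i = -M then j else 0
  eventually_zero := by
    obtain ⟨N, hN⟩ := α.eventually_zero
    refine ⟨min N (-M - 1), fun i hi => ?_⟩
    rw [if_pos (by omega), hN i (by omega)]
  admissible k := by
    rcases lt_trichotomy (k + 1) (-M) with h | h | h
    · rw [if_pos h]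
      refine (α.admissible k).trans_eq ?_
      congr 1
      refine Subtype.ext (funext fun i => ?_)
      have := i.2
      simp only [Set.mem_Iic] at this
      simp only [truncSeq]
      rw [if_pos (by omega)]
    · rw [if_neg (by omega), if_pos h]
      refine j.2.trans_eq ?_
      obtain rfl : k = -(M + 1) := by omega
      unfold branch
      congr 1
      refine Subtype.ext (funext fun i => ?_)
      have := i.2
      simp only [Set.mem_Iic] at this
      simp only [truncSeq]
      rw [if_pos (by omega)]
    · rw [if_neg (by omega), if_neg (by omega)]
      exact lt_of_lt_of_le Nat.zero_lt_two (B.two_le k _)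

theorem child_seq_of_lt (α : TreeSpace B q) {M : ℤ} (j : Fin (α.branch (-(M + 1)))) {i : ℤ}
    (hi : i < -M) : (child α M j).seq i = α.seq i := if_pos hi

theorem child_seq_self (α : TreeSpace B q) {M : ℤ} (j : Fin (α.branch (-(M + 1)))) :
    (child α M j).seq (-M) = j := by
  simp [child]

theorem child_mem_ball [Fact (1 < q)] (α : TreeSpace B q) {M : ℤ}
    (j : Fin (α.branch (-(M + 1)))) : child α M j ∈ ball α M :=
  mem_ball_iff.2 fun _ hi => child_seq_of_lt α j hi

theorem seq_lt_branch_of_mem_ball [Fact (1 < q)] {α β : TreeSpace B q} {M : ℤ}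
    (h : β ∈ ball α M) : β.seq (-M) < α.branch (-(M + 1)) := by
  rw [← branch_eq_of_mem_ball h (by omega)]
  have := β.admissible (-(M + 1))
  rwa [show -(M + 1) + 1 = -M by ring] at this

theorem mem_ball_child_iff [Fact (1 < q)] {α β : TreeSpace B q} {M : ℤ}
    {j : Fin (α.branch (-(M + 1)))} :
    β ∈ ball (child α M j) (M - 1) ↔ β ∈ ball α M ∧ β.seq (-M) = j := by
  simp only [mem_ball_iff]
  constructor
  · intro h
    refine ⟨fun i hi => ?_, ?_⟩
    · rw [h i (by omega), child_seq_of_lt α j hi]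
    · rw [h _ (by omega), child_seq_self]
  · rintro ⟨h, hj⟩ i hi
    rcases lt_or_eq_of_le (show i ≤ -M by omega) with h' | rfl
    · rw [h i h', child_seq_of_lt α j h']
    · rw [hj, child_seq_self]

theorem exists_mem_ball_child [Fact (1 < q)] {α β : TreeSpace B q} {M : ℤ} (h : β ∈ ball α M) :
    ∃ j : Fin (α.branch (-(M + 1))), β ∈ ball (child α M j) (M - 1) :=
  ⟨⟨_, seq_lt_branch_of_mem_ball h⟩, mem_ball_child_iff.2 ⟨h, rfl⟩⟩

theorem ball_eq_iUnion_child [Fact (1 < q)] (α : TreeSpace B q) (M : ℤ) :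
    ball α M = ⋃ j, ball (child α M j) (M - 1) := by
  ext β
  simp only [Set.mem_iUnion]
  exact ⟨exists_mem_ball_child, fun ⟨j, hj⟩ => (mem_ball_child_iff.1 hj).1⟩

/-- Every ball has at least two sub-balls of the next smaller radius. -/
theorem exists_mem_ball_notMem [Fact (1 < q)] (α : TreeSpace B q) (M : ℤ) :
    ∃ β ∈ ball α M, β ∉ ball α (M - 1) := by
  have h2 := two_le_branch α (-(M + 1))
  by_cases h : α.seq (-M) = 0
  · refine ⟨child α M ⟨1, by omega⟩, child_mem_ball _ _, fun hc => ?_⟩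
    have := mem_ball_iff.1 hc (-M) (by omega)
    rw [child_seq_self, h] at this
    simp at this
  · refine ⟨child α M ⟨0, by omega⟩, child_mem_ball _ _, fun hc => ?_⟩
    have := mem_ball_iff.1 hc (-M) (by omega)
    rw [child_seq_self] at this
    exact h this.symm

/-- Branching numbers are at least 2, so a ball is strictly larger than its children. As a set it
therefore determines its radius exponent. -/
theorem le_of_ball_subset [Fact (1 < q)] {α β : TreeSpace B q} {M N : ℤ}
    (h : ball α M ⊆ ball β N) : M ≤ N := by
  by_contra hlt
  obtain ⟨γ, hγ, hγ'⟩ := exists_mem_ball_notMem α M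
  have h1 := h hγ
  rw [← ball_eq_of_mem (h (mem_ball_self α M))] at h1
  exact hγ' (ball_mono α (by omega) h1)

/-! ### Second countability and generating π-systems -/

/-- The truncation of a point before index `k` has finite support. -/
theorem finite_support_trunc (α : TreeSpace B q) (k : ℤ) :
    (Function.support fun i : ℤ => if i < k then α.seq i else 0).Finite := by
  obtain ⟨N, hN⟩ := α.eventually_zero
  refine (Set.finite_Ioo N k).subset fun i hi => ?_
  rw [Function.mem_support] at hi
  refine ⟨?_, ?_⟩
  · by_contra hle
    exact hi (by rw [hN i (not_lt.1 hle)]; simp)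
  · by_contra hle
    exact hi (if_neg hle)

/-- Up to distance `q^(-n)` a point is its truncation before index `n`, an element of the countable
set `ℤ →₀ ℕ`. -/
instance [hq : Fact (1 < q)] : SecondCountableTopology (TreeSpace B q) := by
  refine Metric.secondCountable_of_countable_discretization fun ε hε => ?_
  obtain ⟨n, hn⟩ := exists_zpow_lt (q := q) hε
  refine ⟨ℤ →₀ ℕ, Encodable.ofCountable _,
    fun α => Finsupp.ofSupportFinite _ (finite_support_trunc α n), fun α β h => ?_⟩
  refine le_trans (dist_le_zpow_iff.2 fun i hi => ?_) hn.le
  have := DFunLike.congr_fun h i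
  simp only [Finsupp.ofSupportFinite_coe] at this
  rwa [if_pos (by omega), if_pos (by omega)] at this

theorem borel_eq_generateFrom_ball [hq : Fact (1 < q)] :
    borel (TreeSpace B q) = MeasurableSpace.generateFrom {s | ∃ α N, s = ball α N} := by
  refine TopologicalSpace.IsTopologicalBasis.borel_eq_generateFrom ?_
  refine TopologicalSpace.isTopologicalBasis_of_isOpen_of_nhds ?_ ?_
  · rintro _ ⟨α, N, rfl⟩
    exact isOpen_ball α N
  · intro α u hα hu
    obtain ⟨ε, hε, h⟩ := Metric.isOpen_iff.1 hu α hα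
    obtain ⟨n, hn⟩ := exists_zpow_lt (q := q) hε
    exact ⟨_, ⟨α, -n, rfl⟩, mem_ball_self _ _, (Metric.closedBall_subset_ball hn).trans h⟩

theorem isPiSystem_ball [Fact (1 < q)] :
    IsPiSystem {s : Set (TreeSpace B q) | ∃ α N, s = ball α N} := by
  rintro _ ⟨α, M, rfl⟩ _ ⟨β, N, rfl⟩ ⟨γ, h1, h2⟩
  rw [← ball_eq_of_mem h1, ← ball_eq_of_mem h2]
  rcases le_total M N with h | h
  · exact ⟨γ, M, Set.inter_eq_left.2 (ball_mono γ h)⟩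
  · exact ⟨γ, N, Set.inter_eq_right.2 (ball_mono γ h)⟩

/-- A Borel measure that is finite on balls is determined by its values on balls. -/
theorem measure_ext_of_ball [Fact (1 < q)] {ν ν' : Measure (TreeSpace B q)}
    (h : ∀ α N, ν (ball α N) = ν' (ball α N)) (hfin : ∀ α N, ν (ball α N) ≠ ∞) : ν = ν' := by
  refine Measure.ext_of_generateFrom_of_iUnion _ (fun n : ℕ => ball 0 n)
    borel_eq_generateFrom_ball isPiSystem_ball (iUnion_ball 0) (fun n => ⟨_, _, rfl⟩)
    (fun n => hfin _ _) ?_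
  rintro _ ⟨α, N, rfl⟩
  exact h α N

/-- Equal radii suffice because the product carries the maximum metric; detailed balance is
available for equal radii only. -/
theorem prod_eq_generateFrom_ball [hq : Fact (1 < q)] :
    (inferInstance : MeasurableSpace (TreeSpace B q × TreeSpace B q)) =
      MeasurableSpace.generateFrom {s | ∃ α β N, s = ball α N ×ˢ ball β N} := by
  rw [BorelSpace.measurable_eq (α := TreeSpace B q × TreeSpace B q)]
  refine TopologicalSpace.IsTopologicalBasis.borel_eq_generateFrom ?_
  refine TopologicalSpace.isTopologicalBasis_of_isOpen_of_nhds ?_ ?_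
  · rintro _ ⟨α, β, N, rfl⟩
    exact (isOpen_ball α N).prod (isOpen_ball β N)
  · intro x u hx hu
    obtain ⟨ε, hε, h⟩ := Metric.isOpen_iff.1 hu x hx
    obtain ⟨n, hn⟩ := exists_zpow_lt (q := q) hε
    refine ⟨_, ⟨x.1, x.2, -n, rfl⟩, ⟨mem_ball_self _ _, mem_ball_self _ _⟩, ?_⟩
    rw [ball, ball, closedBall_prod_same]
    exact (Metric.closedBall_subset_ball hn).trans h

theorem isPiSystem_prod_ball [Fact (1 < q)] :
    IsPiSystem {s : Set (TreeSpace B q × TreeSpace B q) |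
      ∃ α β N, s = ball α N ×ˢ ball β N} := by
  rintro _ ⟨α, β, M, rfl⟩ _ ⟨α', β', N, rfl⟩ ⟨γ, ⟨h1, h2⟩, h3, h4⟩
  rw [← ball_eq_of_mem h1, ← ball_eq_of_mem h2, ← ball_eq_of_mem h3, ← ball_eq_of_mem h4]
  rcases le_total M N with h | h
  · exact ⟨γ.1, γ.2, M, Set.inter_eq_left.2
      (Set.prod_mono (ball_mono _ h) (ball_mono _ h))⟩
  · exact ⟨γ.1, γ.2, N, Set.inter_eq_right.2
      (Set.prod_mono (ball_mono _ h) (ball_mono _ h))⟩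

/-- A measure on the square that is finite on products of balls of equal radius is determined by
its values on them. -/
theorem measure_ext_of_prod_ball [Fact (1 < q)] {ν ν' : Measure (TreeSpace B q × TreeSpace B q)}
    (h : ∀ α β N, ν (ball α N ×ˢ ball β N) = ν' (ball α N ×ˢ ball β N))
    (hfin : ∀ α β N, ν (ball α N ×ˢ ball β N) ≠ ∞) : ν = ν' := by
  refine Measure.ext_of_generateFrom_of_iUnion _ (fun n : ℕ => ball 0 n ×ˢ ball 0 n)
    prod_eq_generateFrom_ball isPiSystem_prod_ball ?_ (fun n => ⟨_, _, _, rfl⟩)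
    (fun n => hfin _ _ _) ?_
  · have hm : Monotone fun n : ℕ => (ball 0 n : Set (TreeSpace B q)) :=
      fun m n hmn => ball_mono 0 (by exact_mod_cast hmn)
    rw [Set.iUnion_prod_of_monotone hm hm, iUnion_ball, Set.univ_prod_univ]
  · rintro _ ⟨α, β, N, rfl⟩
    exact h α β N


end TreeSpace

/-! ### Extension of a content on balls to a Borel measure -/

namespace TreeSpace

variable {B : Branching} {q : ℝ} [Fact (1 < q)]

/-- A set function on balls which is well defined and additive over sub-balls. -/
structure IsBallContent (m : TreeSpace B q → ℤ → ℝ≥0∞) : Prop where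
  congr : ∀ {α β : TreeSpace B q} {M : ℤ}, β ∈ ball α M → m β M = m α M
  sum_child : ∀ (α : TreeSpace B q) (M : ℤ), ∑ j, m (child α M j) (M - 1) = m α M

/-- The extension of a set function on balls to all sets, by `∞`. -/
noncomputable def ballCost (m : TreeSpace B q → ℤ → ℝ≥0∞) (s : Set (TreeSpace B q)) : ℝ≥0∞ :=
  ⨅ (α : TreeSpace B q) (N : ℤ) (_ : s = ball α N), m α N

namespace IsBallContent

variable {m : TreeSpace B q → ℤ → ℝ≥0∞} (hm : IsBallContent m)
include hm

/-- The infimum runs over a single value: the set fixes the radius, and `congr` removes the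
dependence on the centre. -/
theorem ballCost_ball (α : TreeSpace B q) (N : ℤ) : ballCost m (ball α N) = m α N := by
  refine le_antisymm (iInf_le_of_le α (iInf_le_of_le N (iInf_le _ rfl))) ?_
  refine le_iInf fun β => le_iInf fun M => le_iInf fun h => ?_
  obtain rfl : N = M := le_antisymm (le_of_ball_subset h.le) (le_of_ball_subset h.ge)
  exact (hm.congr (h ▸ mem_ball_self β N)).ge

theorem le_succ (α : TreeSpace B q) (M : ℤ) : m α M ≤ m α (M + 1) := by
  obtain ⟨j, hj⟩ := exists_mem_ball_child (mem_ball_self α (M + 1))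
  rw [← hm.sum_child α (M + 1)]
  have h := hm.congr hj
  rw [show M + 1 - 1 = M by ring] at h ⊢
  rw [h]
  exact Finset.single_le_sum (f := fun j => m (child α (M + 1) j) M) (fun _ _ => zero_le)
    (Finset.mem_univ j)

theorem monotone (α : TreeSpace B q) : Monotone (m α) := monotone_int_of_le_succ (hm.le_succ α)

theorem le_of_ball_subset_ball {α β : TreeSpace B q} {M N : ℤ} (h : ball α M ⊆ ball β N) :
    m α M ≤ m β N :=
  (hm.monotone α (le_of_ball_subset h)).trans_eq (hm.congr (h (mem_ball_self α M)))

/-- Splitting into children until the radius is at most `q^L` costs nothing by `sum_child`. This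
handles outer measures that control only sets of small diameter. -/
theorem outerMeasure_ball_le (φ : OuterMeasure (TreeSpace B q)) {L : ℤ}
    (h : ∀ α, ∀ M ≤ L, φ (ball α M) ≤ m α M) (α : TreeSpace B q) (N : ℤ) :
    φ (ball α N) ≤ m α N := by
  obtain ⟨n, hn⟩ : ∃ n : ℕ, N ≤ L + n := ⟨(N - L).toNat, by omega⟩
  induction n generalizing α N with
  | zero => exact h α N (by simpa using hn)
  | succ n ih =>
    calc φ (ball α N) = φ (⋃ j, ball (child α N j) (N - 1)) := by rw [← ball_eq_iUnion_child]
      _ ≤ ∑ j, φ (ball (child α N j) (N - 1)) := measure_iUnion_fintype_le φ _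
      _ ≤ ∑ j, m (child α N j) (N - 1) :=
          Finset.sum_le_sum fun j _ => ih _ _ (by push_cast at hn; omega)
      _ = m α N := hm.sum_child α N

end IsBallContent

open Classical in
/-- The share of a covering set `s` in covering the ball `K(α, q^N)`. -/
noncomputable def coverShare (m : TreeSpace B q → ℤ → ℝ≥0∞) (s : Set (TreeSpace B q)) (α : TreeSpace B q)
    (N : ℤ) : ℝ≥0∞ :=
  if s ∩ ball α N = ∅ then 0 else if ball α N ⊆ s then m α N else ballCost m s

/-- A sequence of nested balls has a common point. -/
theorem exists_mem_of_nested (x : ℕ → TreeSpace B q) (N : ℤ)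
    (h : ∀ k : ℕ, x (k + 1) ∈ ball (x k) (N - k)) : ∃ y, ∀ k : ℕ, y ∈ ball (x k) (N - k) := by
  have h' : ∀ k l : ℕ, k ≤ l → x l ∈ ball (x k) (N - k) := by
    intro k l hkl
    induction l, hkl using Nat.le_induction with
    | base => exact mem_ball_self _ _
    | succ l hl ih => exact ball_subset_of_mem ih (by omega) (h l)
  -- Coordinate `i` no longer changes once `i < -(N - k)`, and `d i` is the least such `k`.
  let d : ℤ → ℕ := fun i => (i + N + 1).toNat
  have hd : ∀ (k : ℕ) (i : ℤ), i < -(N - k) → (x (d i)).seq i = (x k).seq i := by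
    intro k i hi
    exact (mem_ball_iff.1 (h' (d i) k (by simp only [d]; omega)) i (by simp only [d]; omega)).symm
  have hd' : ∀ i j : ℤ, i ≤ j → (x (d i)).seq i = (x (d j)).seq i := fun i j hij =>
    hd (d j) i (by simp only [d]; omega)
  have hz : ∃ n : ℤ, ∀ i ≤ n, (x (d i)).seq i = 0 := by
    obtain ⟨n, hn⟩ := (x 0).eventually_zero
    refine ⟨min n (-N - 1), fun i hi => ?_⟩
    rw [hd 0 i (by push_cast; omega), hn i (by omega)]
  refine ⟨⟨fun i => (x (d i)).seq i, hz, fun k => ?_⟩, fun k => mem_ball_iff.2 (hd k)⟩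
  refine ((x (d (k + 1))).admissible k).trans_eq ?_
  congr 1
  exact Subtype.ext (funext fun i => (hd' i (k + 1) (by have := Set.mem_Iic.1 i.2; omega)).symm)

theorem exists_eq_ball_of_ballCost_ne_top {m : TreeSpace B q → ℤ → ℝ≥0∞}
    {s : Set (TreeSpace B q)} (h : ballCost m s ≠ ∞) : ∃ α N, s = ball α N := by
  by_contra hc
  push Not at hc
  refine h ?_
  simp only [ballCost, iInf_eq_top]
  exact fun α N hs => absurd hs (hc α N)

namespace IsBallContent

variable {m : TreeSpace B q → ℤ → ℝ≥0∞} (hm : IsBallContent m)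
include hm

/-- The supremum over `s.Nonempty` is the form in which `OuterMeasure.boundedBy_apply` charges a
covering set. -/
theorem coverShare_le (s : Set (TreeSpace B q)) (α : TreeSpace B q) (N : ℤ) :
    coverShare m s α N ≤ ⨆ _ : s.Nonempty, ballCost m s := by
  unfold coverShare
  split_ifs with h1 h2
  · exact zero_le
  · have hs : s.Nonempty := ⟨α, h2 (mem_ball_self α N)⟩
    rw [iSup_pos hs]
    by_cases h : ballCost m s = ∞
    · simp [h]
    · obtain ⟨β, M, rfl⟩ := exists_eq_ball_of_ballCost_ne_top h
      rw [hm.ballCost_ball]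
      exact hm.le_of_ball_subset_ball h2
  · have hs : s.Nonempty := (Set.nonempty_iff_ne_empty.2 h1).left
    rw [iSup_pos hs]

/-- If `s` contains the ball, the shares are the contents of the children and add up. Otherwise an
`s` of finite cost meeting the ball is a smaller ball, which lies in one child and misses the
others. -/
theorem sum_coverShare_child_le (s : Set (TreeSpace B q)) (α : TreeSpace B q) (N : ℤ) :
    ∑ j, coverShare m s (child α N j) (N - 1) ≤ coverShare m s α N := by
  have hsub : ∀ j, ball (child α N j) (N - 1) ⊆ ball α N := fun j =>
    ball_subset_of_mem (child_mem_ball α j) (by omega)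
  by_cases h1 : s ∩ ball α N = ∅
  · have h0 : ∀ j, coverShare m s (child α N j) (N - 1) = 0 := fun j =>
      if_pos (Set.subset_empty_iff.1 ((Set.inter_subset_inter_right s (hsub j)).trans h1.le))
    simp [h0]
  by_cases h2 : ball α N ⊆ s
  · rw [coverShare, if_neg h1, if_pos h2, ← hm.sum_child]
    refine Finset.sum_le_sum fun j _ => ?_
    unfold coverShare
    rw [if_pos ((hsub j).trans h2)]
    split_ifs <;> simp
  rw [show coverShare m s α N = ballCost m s by rw [coverShare, if_neg h1, if_neg h2]]
  by_cases h3 : ballCost m s = ∞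
  · simp [h3]
  obtain ⟨β, L, rfl⟩ := exists_eq_ball_of_ballCost_ne_top h3
  obtain ⟨γ, hγ, hγ'⟩ := Set.nonempty_iff_ne_empty.2 h1
  have hL : L < N := by
    by_contra hle
    refine h2 ?_
    rw [← ball_eq_of_mem hγ, ← ball_eq_of_mem hγ']
    exact ball_mono γ (by omega)
  obtain ⟨j, hj⟩ := exists_mem_ball_child hγ'
  have hβj : ball β L ⊆ ball (child α N j) (N - 1) := by
    rw [← ball_eq_of_mem hγ]
    exact ball_subset_of_mem hj (by omega)
  rw [Finset.sum_eq_single j]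
  · refine (hm.coverShare_le _ _ _).trans ?_
    rw [iSup_pos ⟨γ, hγ⟩]
  · intro i _ hij
    refine if_pos (Set.eq_empty_of_forall_notMem fun δ hδ => hij ?_)
    have e1 := (mem_ball_child_iff.1 hδ.2).2
    have e2 := (mem_ball_child_iff.1 (hβj hδ.1)).2
    exact Fin.ext (e1.symm.trans e2)
  · simp

/-- A cover that is too cheap has total share below the content on some child, then on some
grandchild, and so on. The common point of these nested balls lies in one covering ball, which
contains all sufficiently small balls of the sequence. There its share alone equals the full
content, a contradiction. -/
theorem le_boundedBy_ball (α : TreeSpace B q) (N : ℤ) :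
    m α N ≤ OuterMeasure.boundedBy (ballCost m) (ball α N) := by
  rw [OuterMeasure.boundedBy_apply]
  refine le_iInf₂ fun s hs => ?_
  by_contra hlt
  rw [not_le] at hlt
  have step : ∀ β (M : ℤ), ∑' n, coverShare m (s n) β M < m β M →
      ∃ j, ∑' n, coverShare m (s n) (child β M j) (M - 1) < m (child β M j) (M - 1) := by
    intro β M hβ
    by_contra hc
    push Not at hc
    refine absurd hβ (not_lt.2 ?_)
    calc m β M = ∑ j, m (child β M j) (M - 1) := (hm.sum_child β M).symm
      _ ≤ ∑ j, ∑' n, coverShare m (s n) (child β M j) (M - 1) :=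
          Finset.sum_le_sum fun j _ => hc j
      _ = ∑' n, ∑ j, coverShare m (s n) (child β M j) (M - 1) :=
          (Summable.tsum_finsetSum fun _ _ => ENNReal.summable).symm
      _ ≤ _ := ENNReal.tsum_le_tsum fun n => hm.sum_coverShare_child_le _ _ _
  have h0 : ∑' n, coverShare m (s n) α N < m α N :=
    (ENNReal.tsum_le_tsum fun n => hm.coverShare_le _ _ _).trans_lt hlt
  have step' : ∀ (β : TreeSpace B q) (M : ℤ), ∃ γ ∈ ball β M,
      (∑' n, coverShare m (s n) β M < m β M →
        ∑' n, coverShare m (s n) γ (M - 1) < m γ (M - 1)) := by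
    intro β M
    by_cases h : ∑' n, coverShare m (s n) β M < m β M
    · obtain ⟨j, hj⟩ := step β M h
      exact ⟨_, child_mem_ball β j, fun _ => hj⟩
    · exact ⟨β, mem_ball_self β M, fun h' => absurd h' h⟩
  choose f hf hf' using step'
  let x : ℕ → TreeSpace B q := fun k => Nat.rec α (fun k β => f β (N - k)) k
  have hx : ∀ k : ℕ, ∑' n, coverShare m (s n) (x k) (N - k) < m (x k) (N - k) := by
    intro k
    induction k with
    | zero => simpa [x] using h0
    | succ k ih =>
      have := hf' _ _ ih
      rwa [show N - (k : ℤ) - 1 = N - ((k + 1 : ℕ) : ℤ) by push_cast; ring] at this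
  obtain ⟨y, hy⟩ := exists_mem_of_nested x N fun k => hf _ _
  obtain ⟨n, hn⟩ := Set.mem_iUnion.1 (hs (by simpa [x] using hy 0))
  have hlt' : ∀ k : ℕ, coverShare m (s n) (x k) (N - k) < m (x k) (N - k) := fun k =>
    (ENNReal.le_tsum n).trans_lt (hx k)
  have hne : ∀ k : ℕ, s n ∩ ball (x k) (N - k) ≠ ∅ := fun k =>
    Set.Nonempty.ne_empty ⟨y, hn, hy k⟩
  have hns : ∀ k : ℕ, ¬ ball (x k) (N - k) ⊆ s n := by
    intro k hk
    have := hlt' k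
    rw [coverShare, if_neg (hne k), if_pos hk] at this
    exact lt_irrefl _ this
  have hcost : ballCost m (s n) ≠ ∞ := by
    have := hlt' 0
    rw [coverShare, if_neg (hne 0), if_neg (hns 0)] at this
    exact this.ne_top
  obtain ⟨β, L, hβ⟩ := exists_eq_ball_of_ballCost_ne_top hcost
  refine hns (N - L).toNat ?_
  rw [hβ, ← ball_eq_of_mem (hy _)]
  exact ball_subset_of_mem (hβ ▸ hn) (by omega)

theorem measureOfBalls_ball (α : TreeSpace B q) (N : ℤ) :
    measureOfBalls m (ball α N) = m α N := by
  have hq : 1 < q := Fact.out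
  rw [measureOfBalls, Measure.mkMetric', toMeasure_apply _ _ (measurableSet_ball α N)]
  change OuterMeasure.mkMetric' (ballCost m) (ball α N) = m α N
  refine le_antisymm ?_ ?_
  · refine le_of_tendsto (OuterMeasure.mkMetric'.tendsto_pre _ _) ?_
    filter_upwards [self_mem_nhdsWithin] with r hr
    obtain ⟨ε, hε, hεr⟩ : ∃ ε : ℝ, 0 < ε ∧ ENNReal.ofReal ε ≤ r := by
      by_cases h : r = ∞
      · exact ⟨1, one_pos, by simp [h]⟩
      · exact ⟨r.toReal, ENNReal.toReal_pos hr.ne' h, ENNReal.ofReal_toReal_le⟩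
    obtain ⟨n, hn⟩ := exists_zpow_lt (q := q) hε
    refine hm.outerMeasure_ball_le _ (L := -n) (fun β M hM => ?_) α N
    refine (OuterMeasure.mkMetric'.pre_le ?_).trans (hm.ballCost_ball β M).le
    refine le_trans (Metric.ediam_le_of_forall_dist_le fun γ hγ δ hδ => ?_)
      ((ENNReal.ofReal_le_ofReal hn.le).trans hεr)
    refine dist_le_zpow_iff.2 fun i hi => ?_
    rw [mem_ball_iff.1 hγ i (by omega), mem_ball_iff.1 hδ i (by omega)]
  · refine (hm.le_boundedBy_ball α N).trans ?_
    -- `boundedBy` admits covers by sets of any diameter, so it lies below `pre` at every scale; the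
    -- scale 1 is arbitrary.
    have h1 : OuterMeasure.boundedBy (ballCost m) ≤
        OuterMeasure.mkMetric'.pre (ballCost m) 1 :=
      OuterMeasure.mkMetric'.le_pre.2 fun s _ => OuterMeasure.boundedBy_le s
    refine (h1 _).trans ?_
    rw [OuterMeasure.mkMetric']
    exact (le_iSup₂ (f := fun r (_ : r > 0) => OuterMeasure.mkMetric'.pre (ballCost m) r)
      (1 : ℝ≥0∞) one_pos) (ball α N)

end IsBallContent


end TreeSpace

/-! ### The reference measure -/

namespace TreeSpace

variable {B : Branching} {q : ℝ}

theorem _root_.Int.prod_Ioc_succ_right {R : Type*} [CommMonoid R] (f : ℤ → R) {a b : ℤ}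
    (h : a ≤ b) : ∏ l ∈ Finset.Ioc a (b + 1), f l = f (b + 1) * ∏ l ∈ Finset.Ioc a b, f l := by
  rw [← Finset.prod_insert (by simp)]
  congr 1
  ext i
  simp only [Finset.mem_Ioc, Finset.mem_insert]
  omega

theorem _root_.Int.prod_Ioc_pred_left {R : Type*} [CommMonoid R] (f : ℤ → R) {a b : ℤ}
    (h : a ≤ b) : ∏ l ∈ Finset.Ioc (a - 1) b, f l = f a * ∏ l ∈ Finset.Ioc a b, f l := by
  rw [← Finset.prod_insert (by simp)]
  congr 1
  ext i
  simp only [Finset.mem_Ioc, Finset.mem_insert]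
  omega

theorem branch_ne_zero (α : TreeSpace B q) (k : ℤ) : (α.branch k : ℝ≥0∞) ≠ 0 := by
  have := two_le_branch α k
  exact_mod_cast (show α.branch k ≠ 0 by omega)

theorem prod_branch_ne_zero (α : TreeSpace B q) (s : Finset ℤ) (f : ℤ → ℤ) :
    ∏ l ∈ s, (α.branch (f l) : ℝ≥0∞) ≠ 0 :=
  Finset.prod_ne_zero_iff.2 fun _ _ => branch_ne_zero α _

theorem prod_branch_ne_top (α : TreeSpace B q) (s : Finset ℤ) (f : ℤ → ℤ) :
    ∏ l ∈ s, (α.branch (f l) : ℝ≥0∞) ≠ ∞ :=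
  ENNReal.prod_ne_top fun _ _ => ENNReal.natCast_ne_top _

variable [Fact (1 < q)]

/-- The mass of a ball can be computed via any sufficiently large ball around `0`. -/
theorem ballMass_eq {α : TreeSpace B q} {M N : ℤ} (h0 : 0 ≤ N) (hM : M ≤ N) (hα : α ∈ ball 0 N) :
    ballMass α M = (∏ l ∈ Finset.Ioc 0 N, ((0 : TreeSpace B q).branch (-(l + 1)) : ℝ≥0∞)) /
      ∏ l ∈ Finset.Ioc M N, (α.branch (-(l + 1)) : ℝ≥0∞) := by
  have hN : max (max 0 M) (-(firstDiff α 0)) ≤ N := by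
    refine max_le (max_le h0 hM) ?_
    -- For `α = 0` no index differs and `firstDiff` takes the default value `sInf ∅ = 0`.
    by_cases h : α = 0
    · subst h
      simpa [firstDiff] using h0
    · have := le_firstDiff h (mem_ball_iff.1 hα)
      omega
  have hα' : α ∈ ball 0 (max (max 0 M) (-(firstDiff α 0))) :=
    mem_ball_iff.2 fun i hi => seq_eq_of_lt_firstDiff (by omega)
  unfold ballMass
  generalize hK : max (max 0 M) (-(firstDiff α 0)) = K at *
  clear h0 hM hα
  have h0 : 0 ≤ K := by omega
  have hM : M ≤ K := by omega
  clear hK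
  induction N, hN using Int.leInduction with
  | base => rfl
  | succ N hN ih =>
    -- Both products gain the branching number of the common ball `K(0, q^(N+1))`, which cancels.
    rw [ih, Int.prod_Ioc_succ_right _ (h0.trans hN), Int.prod_Ioc_succ_right _ (hM.trans hN),
      branch_eq_of_mem_ball hα' (by omega), ENNReal.mul_div_mul_left _ _ (branch_ne_zero _ _)
      (ENNReal.natCast_ne_top _)]

theorem exists_large_ball (α β : TreeSpace B q) (M : ℤ) :
    ∃ N : ℤ, 0 ≤ N ∧ M ≤ N ∧ α ∈ ball 0 N ∧ β ∈ ball 0 N := by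
  obtain ⟨k, hk⟩ := exists_mem_ball 0 α (max M 0)
  obtain ⟨l, hl⟩ := exists_mem_ball 0 β (max M 0)
  exact ⟨max M 0 + max k l, by omega, by omega, ball_mono 0 (by omega) hk,
    ball_mono 0 (by omega) hl⟩

theorem ballMass_ne_top (α : TreeSpace B q) (M : ℤ) : ballMass α M ≠ ∞ := by
  obtain ⟨N, h0, hM, hα, -⟩ := exists_large_ball α α M
  rw [ballMass_eq h0 hM hα]
  exact ENNReal.div_ne_top (prod_branch_ne_top _ _ _) (prod_branch_ne_zero _ _ _)

theorem ballMass_congr {α β : TreeSpace B q} {M : ℤ} (h : β ∈ ball α M) :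
    ballMass β M = ballMass α M := by
  obtain ⟨N, h0, hM, hα, hβ⟩ := exists_large_ball α β M
  rw [ballMass_eq h0 hM hα, ballMass_eq h0 hM hβ]
  congr 1
  refine Finset.prod_congr rfl fun l hl => ?_
  rw [branch_eq_of_mem_ball h (by have := Finset.mem_Ioc.1 hl; omega)]

theorem ballMass_eq_branch_mul (α : TreeSpace B q) (M : ℤ) :
    ballMass α M = (α.branch (-(M + 1)) : ℝ≥0∞) * ballMass α (M - 1) := by
  obtain ⟨N, h0, hM, hα, -⟩ := exists_large_ball α α M
  rw [ballMass_eq h0 hM hα, ballMass_eq h0 (by omega) hα, Int.prod_Ioc_pred_left _ hM,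
    ← mul_div_assoc, ENNReal.mul_div_mul_left _ _ (branch_ne_zero _ _) (ENNReal.natCast_ne_top _)]

variable (B q) in
theorem isBallContent_ballMass : IsBallContent (ballMass (B := B) (q := q)) where
  congr := ballMass_congr
  sum_child α M := by
    have h : ∀ j, ballMass (child α M j) (M - 1) = ballMass α (M - 1) := fun j => by
      have h1 := ballMass_congr (child_mem_ball α j)
      rw [ballMass_eq_branch_mul, ballMass_eq_branch_mul α M,
        branch_eq_of_mem_ball (child_mem_ball α j) (by omega)] at h1
      exact (ENNReal.mul_right_inj (branch_ne_zero _ _) (ENNReal.natCast_ne_top _)).1 h1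
    rw [Finset.sum_congr rfl fun j _ => h j, ballMass_eq_branch_mul α M]
    simp

theorem mu_ball (α : TreeSpace B q) (M : ℤ) : mu B q (ball α M) = ballMass α M :=
  (isBallContent_ballMass B q).measureOfBalls_ball α M

variable (B q) in
theorem ballMass_zero : ballMass (0 : TreeSpace B q) 0 = 1 := by
  rw [ballMass_eq le_rfl le_rfl (mem_ball_self 0 0)]
  simp

/-- The normalisation propagates upwards along balls around `0` to one containing `α`, and from
there down to `K(α, q^M)` by cancelling branching numbers, which are nonzero and finite. -/
theorem measure_ball_eq_ballMass {ν : Measure (TreeSpace B q)} (h1 : ν (ball 0 0) = 1)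
    (h : ∀ (α : TreeSpace B q) (M : ℤ),
      ν (ball α M) = (α.branch (-(M + 1)) : ℝ≥0∞) * ν (ball α (M - 1)))
    (α : TreeSpace B q) (M : ℤ) : ν (ball α M) = ballMass α M := by
  have h0 : ∀ N : ℤ, 0 ≤ N → ν (ball 0 N) = ballMass (0 : TreeSpace B q) N := by
    intro N hN
    induction N, hN using Int.leInduction with
    | base => rw [h1, ballMass_zero]
    | succ N hN ih => rw [h, ballMass_eq_branch_mul, add_sub_cancel_right, ih]
  obtain ⟨N, hN, hM, hα, -⟩ := exists_large_ball α α M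
  have hN' : ν (ball α N) = ballMass α N := by
    rw [ball_eq_of_mem hα, ballMass_congr hα, h0 N hN]
  clear hN hα
  induction M, hM using Int.leInductionDown with
  | base => exact hN'
  | pred M hM ih =>
    rw [h, ballMass_eq_branch_mul] at ih
    exact (ENNReal.mul_right_inj (branch_ne_zero _ _) (ENNReal.natCast_ne_top _)).1 ih

theorem eq_mu {ν : Measure (TreeSpace B q)} (h1 : ν (ball 0 0) = 1)
    (h : ∀ (α : TreeSpace B q) (M : ℤ),
      ν (ball α M) = (α.branch (-(M + 1)) : ℝ≥0∞) * ν (ball α (M - 1))) : ν = mu B q :=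
  measure_ext_of_ball (fun α N => by rw [measure_ball_eq_ballMass h1 h, mu_ball])
    fun α N => by rw [measure_ball_eq_ballMass h1 h]; exact ballMass_ne_top α N

instance : SigmaFinite (mu B q) :=
  ⟨⟨{ set := fun n => ball 0 n
      set_mem := fun _ => trivial
      finite := fun n => by rw [mu_ball]; exact (ballMass_ne_top _ _).lt_top
      spanning := iUnion_ball 0 }⟩⟩

end TreeSpace

/-! ### Jump rates and the probability of staying in a ball -/

theorem hasSum_sub_succ {f : ℕ → ℝ} (hf : ∀ n, f (n + 1) ≤ f n) (h0 : Tendsto f atTop (𝓝 0)) :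
    HasSum (fun n => f n - f (n + 1)) (f 0) := by
  rw [hasSum_iff_tendsto_nat_of_nonneg fun n => sub_nonneg.2 (hf n)]
  simp only [Finset.sum_range_sub']
  simpa using h0.const_sub (f 0)

/-- Rates of a pure jump process: antitone in the logarithm of the distance, and vanishing at
infinity. -/
structure IsJumpRate (a : ℤ → ℝ) : Prop where
  succ_le : ∀ N : ℤ, a (N + 1) ≤ a N
  tendsto_zero : Tendsto a atTop (𝓝 0)

theorem IsJumpRate.antitone {a : ℤ → ℝ} (ha : IsJumpRate a) : Antitone a :=
  antitone_int_of_succ_le ha.succ_le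

theorem IsJumpRate.nonneg {a : ℤ → ℝ} (ha : IsJumpRate a) (N : ℤ) : 0 ≤ a N :=
  ha.antitone.le_of_tendsto ha.tendsto_zero N

theorem tendsto_intCast_add_natCast (M : ℤ) : Tendsto (fun n : ℕ => M + (n : ℤ)) atTop atTop :=
  tendsto_atTop_add_const_left _ _ tendsto_natCast_atTop_atTop

namespace TreeSpace

variable {B : Branching} {q : ℝ} {a : ℤ → ℝ}

theorem two_le_branch_real (α : TreeSpace B q) (k : ℤ) : (2 : ℝ) ≤ α.branch k := by
  exact_mod_cast two_le_branch α k

theorem branch_real_pos (α : TreeSpace B q) (k : ℤ) : (0 : ℝ) < α.branch k := by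
  linarith [two_le_branch_real α k]

theorem branch_real_ne_zero (α : TreeSpace B q) (k : ℤ) : (α.branch k : ℝ) ≠ 0 :=
  (branch_real_pos α k).ne'

theorem bigB_one (α : TreeSpace B q) (N : ℤ) : bigB α 1 N = α.branch (-(N + 2)) - 1 := by
  simp [bigB, add_assoc, one_add_one_eq_two]

theorem bigB_succ (α : TreeSpace B q) {m : ℕ} (hm : 1 ≤ m) (M : ℤ) :
    bigB α (m + 1) M = α.branch (-(M + 2)) * bigB α m (M + 1) := by
  have h : ∏ l ∈ Finset.Icc 2 (m + 1), (α.branch (-(M + l)) : ℝ) =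
      α.branch (-(M + 2)) * ∏ l ∈ Finset.Icc 2 m, (α.branch (-(M + 1 + l)) : ℝ) := by
    induction m, hm using Nat.le_induction with
    | base => simp
    | succ m hm ih =>
      rw [Finset.prod_Icc_succ_top (by omega), ih, Finset.prod_Icc_succ_top (by omega)]
      push_cast
      rw [show M + 1 + ((m : ℤ) + 1) = M + ((m : ℤ) + 1 + 1) by ring]
      ring
  unfold bigB
  rw [h]
  push_cast
  rw [show M + 1 + (m : ℤ) + 1 = M + ((m : ℤ) + 1) + 1 by ring]
  ring

theorem bigB_nonneg (α : TreeSpace B q) (m : ℕ) (M : ℤ) : 0 ≤ bigB α m M :=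
  mul_nonneg (by linarith [two_le_branch_real α (-(M + m + 1))])
    (Finset.prod_nonneg fun _ _ => (branch_real_pos α _).le)

theorem rate_one (α : TreeSpace B q) (N : ℤ) :
    rate a α 1 N = ((α.branch (-(N + 2)) : ℝ) - 1)⁻¹ * (a N - a (N + 1)) := by
  simp [rate, bigB_one]

theorem rate_one_nonneg (ha : IsJumpRate a) (α : TreeSpace B q) (N : ℤ) : 0 ≤ rate a α 1 N := by
  rw [rate_one]
  exact mul_nonneg (inv_nonneg.2 (by linarith [two_le_branch_real α (-(N + 2))]))
    (sub_nonneg.2 (ha.succ_le N))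

theorem decay_pos (α : TreeSpace B q) (N : ℤ) (t : ℝ) : 0 < decay a α N t := Real.exp_pos _

theorem decay_le_exp (ha : IsJumpRate a) (α : TreeSpace B q) (N : ℤ) {t : ℝ} (ht : 0 ≤ t) :
    decay a α N t ≤ Real.exp (-a N * t) :=
  Real.exp_le_exp.2 (by nlinarith [mul_nonneg (rate_one_nonneg ha α N) ht])

theorem decay_le_one (ha : IsJumpRate a) (α : TreeSpace B q) (N : ℤ) {t : ℝ} (ht : 0 ≤ t) :
    decay a α N t ≤ 1 :=
  (decay_le_exp ha α N ht).trans
    (Real.exp_le_one_iff.2 (by nlinarith [mul_nonneg (ha.nonneg N) ht]))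

theorem decay_add (α : TreeSpace B q) (N : ℤ) (t s : ℝ) :
    decay a α N (t + s) = decay a α N t * decay a α N s := by
  rw [decay, decay, decay, ← Real.exp_add]
  ring_nf

/-- The weight of the `n`-th exponential in the probability of staying in a ball. -/
noncomputable def stayWeight (α : TreeSpace B q) (M : ℤ) (n : ℕ) : ℝ :=
  (∏ l ∈ Finset.range (n + 1), (α.branch (-(M + l + 2)) : ℝ))⁻¹ *
    ((α.branch (-(M + n + 2)) : ℝ) - 1)

/-- The inverse of the number of balls of radius `q ^ M` in one of radius `q ^ (M + n)`. -/
noncomputable def massRatio (α : TreeSpace B q) (M : ℤ) (n : ℕ) : ℝ :=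
  (∏ l ∈ Finset.range n, (α.branch (-(M + l + 2)) : ℝ))⁻¹

theorem massRatio_pos (α : TreeSpace B q) (M : ℤ) (n : ℕ) : 0 < massRatio α M n :=
  inv_pos.2 (Finset.prod_pos fun _ _ => branch_real_pos α _)

theorem massRatio_eq_mul_succ (α : TreeSpace B q) (M : ℤ) (n : ℕ) :
    massRatio α M n = α.branch (-(M + n + 2)) * massRatio α M (n + 1) := by
  have := branch_real_ne_zero α (-(M + n + 2))
  rw [massRatio, massRatio, Finset.prod_range_succ, mul_inv_rev, ← mul_assoc,
    mul_inv_cancel₀ this, one_mul]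

/-- This form makes sums against the weights telescope. -/
theorem stayWeight_eq (α : TreeSpace B q) (M : ℤ) (n : ℕ) :
    stayWeight α M n = massRatio α M n - massRatio α M (n + 1) := by
  rw [massRatio_eq_mul_succ α M n, stayWeight, massRatio]
  ring

theorem two_mul_massRatio_succ_le (α : TreeSpace B q) (M : ℤ) (n : ℕ) :
    2 * massRatio α M (n + 1) ≤ massRatio α M n := by
  rw [massRatio_eq_mul_succ α M n]
  exact mul_le_mul_of_nonneg_right (two_le_branch_real α _) (massRatio_pos α M _).le

theorem massRatio_le (α : TreeSpace B q) (M : ℤ) (n : ℕ) : massRatio α M n ≤ (1 / 2) ^ n := by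
  induction n with
  | zero => simp [massRatio]
  | succ n ih =>
    rw [pow_succ]
    linarith [two_mul_massRatio_succ_le α M n]

theorem massRatio_succ_le (α : TreeSpace B q) (M : ℤ) (n : ℕ) :
    massRatio α M (n + 1) ≤ massRatio α M n := by
  linarith [two_mul_massRatio_succ_le α M n, massRatio_pos α M (n + 1)]

theorem tendsto_massRatio (α : TreeSpace B q) (M : ℤ) :
    Tendsto (massRatio α M) atTop (𝓝 0) :=
  squeeze_zero (fun n => (massRatio_pos α M n).le) (massRatio_le α M)
    (tendsto_pow_atTop_nhds_zero_of_lt_one (by norm_num) (by norm_num))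

theorem stayWeight_nonneg (α : TreeSpace B q) (M : ℤ) (n : ℕ) : 0 ≤ stayWeight α M n := by
  rw [stayWeight_eq]
  exact sub_nonneg.2 (massRatio_succ_le α M n)

theorem hasSum_stayWeight (α : TreeSpace B q) (M : ℤ) : HasSum (stayWeight α M) 1 := by
  have := hasSum_sub_succ (massRatio_succ_le α M) (tendsto_massRatio α M)
  simp only [← stayWeight_eq] at this
  simpa [massRatio] using this

/-- The mean exponent is the jump rate. -/
theorem hasSum_stayWeight_mul_rate (ha : IsJumpRate a) (α : TreeSpace B q) (M : ℤ) :
    HasSum (fun n : ℕ => stayWeight α M n * (a (M + n) + rate a α 1 (M + n))) (a M) := by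
  -- With `r_n` the mass ratio and `b` the branching number at `-(M+n+2)`, the weight is `(b - 1)
  -- r_{n+1}` and `r_n = b r_{n+1}`. The factor `(b - 1)⁻¹` in the rate cancels, so the `n`-th term
  -- is `r_n a(M+n) - r_{n+1} a(M+n+1)`.
  have key := hasSum_sub_succ (f := fun n : ℕ => massRatio α M n * a (M + n)) ?_ ?_
  · convert key using 1
    · funext n
      have hb := two_le_branch_real α (-(M + n + 2))
      have hb' : (α.branch (-(M + n + 2)) : ℝ) - 1 ≠ 0 := by linarith
      rw [stayWeight_eq, massRatio_eq_mul_succ α M n, rate_one]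
      push_cast
      rw [← add_assoc]
      field_simp
      ring
    · simp [massRatio]
  · intro n
    refine mul_le_mul (massRatio_succ_le α M n) (ha.antitone ?_) (ha.nonneg _)
      (massRatio_pos α M n).le
    push_cast
    omega
  · simpa using (tendsto_massRatio α M).mul
      (ha.tendsto_zero.comp (tendsto_intCast_add_natCast M))

theorem stayProb_eq_tsum (α : TreeSpace B q) (M : ℤ) (t : ℝ) :
    stayProb a α M t = ∑' n : ℕ, stayWeight α M n * decay a α (M + n) t := rfl

theorem summable_stayProb (ha : IsJumpRate a) (α : TreeSpace B q) (M : ℤ) {t : ℝ} (ht : 0 ≤ t) :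
    Summable fun n : ℕ => stayWeight α M n * decay a α (M + n) t :=
  (hasSum_stayWeight α M).summable.of_nonneg_of_le
    (fun n => mul_nonneg (stayWeight_nonneg α M n) (decay_pos α _ t).le)
    fun n => mul_le_of_le_one_right (stayWeight_nonneg α M n) (decay_le_one ha α _ ht)

theorem stayProb_le_one (ha : IsJumpRate a) (α : TreeSpace B q) (M : ℤ) {t : ℝ} (ht : 0 ≤ t) :
    stayProb a α M t ≤ 1 :=
  hasSum_le (fun n => mul_le_of_le_one_right (stayWeight_nonneg α M n) (decay_le_one ha α _ ht))
    (summable_stayProb ha α M ht).hasSum (hasSum_stayWeight α M)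

/-- Jensen's inequality for the probability of staying in a ball. -/
theorem exp_le_stayProb (ha : IsJumpRate a) (α : TreeSpace B q) (M : ℤ) {t : ℝ} (ht : 0 ≤ t) :
    Real.exp (-a M * t) ≤ stayProb a α M t := by
  -- The tangent line of the exponential at the mean exponent `a M`, averaged with the weights; its
  -- linear part averages to zero.
  have h1 := ((hasSum_stayWeight α M).mul_right (Real.exp (-a M * t) * (1 + a M * t))).sub
    ((hasSum_stayWeight_mul_rate ha α M).mul_right (Real.exp (-a M * t) * t))
  have h2 : 1 * (Real.exp (-a M * t) * (1 + a M * t)) - a M * (Real.exp (-a M * t) * t) =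
      Real.exp (-a M * t) := by ring
  rw [h2] at h1
  refine hasSum_le (fun n => ?_) h1 (summable_stayProb ha α M ht).hasSum
  have h3 : decay a α (M + n) t = Real.exp (-a M * t) *
      Real.exp (-(a (M + n) + rate a α 1 (M + n) - a M) * t) := by
    rw [decay, ← Real.exp_add]
    ring_nf
  have h4 := Real.add_one_le_exp (-(a (M + n) + rate a α 1 (M + n) - a M) * t)
  rw [h3]
  refine le_trans (le_of_eq ?_) (mul_le_mul_of_nonneg_left
    (mul_le_mul_of_nonneg_left h4 (Real.exp_pos (-a M * t)).le) (stayWeight_nonneg α M n))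
  ring

/-- This is the sign of the bracket in the jump probabilities: `E(M-1) ≤ exp(-a(M-1) t) ≤ exp(-a(M)
t) ≤ Q(M)`. -/
theorem decay_le_stayProb (ha : IsJumpRate a) (α : TreeSpace B q) (M : ℤ) {t : ℝ} (ht : 0 ≤ t) :
    decay a α (M - 1) t ≤ stayProb a α M t := by
  refine (decay_le_exp ha α (M - 1) ht).trans (le_trans ?_ (exp_le_stayProb ha α M ht))
  exact Real.exp_le_exp.2 (mul_le_mul_of_nonneg_right
    (neg_le_neg (ha.antitone (by omega))) ht)

theorem stayProb_nonneg (ha : IsJumpRate a) (α : TreeSpace B q) (M : ℤ) {t : ℝ} (ht : 0 ≤ t) :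
    0 ≤ stayProb a α M t := (Real.exp_pos _).le.trans (exp_le_stayProb ha α M ht)

/-- Apart from the term `n = 0`, the series is `b⁻¹` times the series at level `M + 1`. -/
theorem stayProb_eq (ha : IsJumpRate a) (α : TreeSpace B q) (M : ℤ) {t : ℝ} (ht : 0 ≤ t) :
    stayProb a α M t = (α.branch (-(M + 2)) : ℝ)⁻¹ *
      (stayProb a α (M + 1) t - decay a α M t) + decay a α M t := by
  have hb := branch_real_ne_zero α (-(M + 2))
  have h0 : stayWeight α M 0 = 1 - (α.branch (-(M + 2)) : ℝ)⁻¹ := by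
    rw [stayWeight]
    simp only [zero_add, Finset.prod_range_one, Nat.cast_zero, add_zero]
    rw [mul_sub, inv_mul_cancel₀ hb, mul_one]
  have hs : ∀ n : ℕ, stayWeight α M (n + 1) * decay a α (M + ((n + 1 : ℕ) : ℤ)) t =
      (α.branch (-(M + 2)) : ℝ)⁻¹ * (stayWeight α (M + 1) n * decay a α (M + 1 + n) t) := by
    intro n
    have h1 : ∀ l : ℕ, M + ((l + 1 : ℕ) : ℤ) = M + 1 + l := fun l => by push_cast; ring
    rw [stayWeight, Finset.prod_range_succ']
    simp only [h1]
    rw [stayWeight, mul_inv_rev]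
    simp only [Nat.cast_zero, add_zero]
    ring
  rw [stayProb_eq_tsum, (summable_stayProb ha α M ht).tsum_eq_zero_add, h0]
  simp only [hs]
  rw [tsum_mul_left, ← stayProb_eq_tsum]
  simp only [Nat.cast_zero, add_zero]
  ring

/-! ### Transition probabilities on balls and their recursion -/

variable [Fact (1 < q)]

/-- The only branching number in `E(·, N, t)` is that of the ball of radius `q^(N+1)`, hence the
radius one step larger than `N`. -/
theorem decay_congr {α β : TreeSpace B q} {N : ℤ} (h : β ∈ ball α (N + 1)) (t : ℝ) :
    decay a β N t = decay a α N t := by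
  rw [decay, decay, rate_one, rate_one, branch_eq_of_mem_ball h (by omega)]

theorem stayProb_congr {α β : TreeSpace B q} {M : ℤ} (h : β ∈ ball α M) (t : ℝ) :
    stayProb a β M t = stayProb a α M t := by
  simp only [stayProb_eq_tsum]
  refine tsum_congr fun n => ?_
  rw [decay_congr (ball_mono α (by omega) h)]
  congr 1
  rw [stayWeight, stayWeight, branch_eq_of_mem_ball h (by omega)]
  congr 2
  exact Finset.prod_congr rfl fun l _ => by rw [branch_eq_of_mem_ball h (by omega)]

theorem ballProb_of_mem {η β : TreeSpace B q} {M : ℤ} (h : η ∈ ball β M) (t : ℝ) :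
    ballProb a t η β M = stayProb a η M t := if_pos h

theorem ballProb_of_notMem {η β : TreeSpace B q} {M : ℤ} (h : η ∉ ball β M) (t : ℝ) :
    ballProb a t η β M = jumpProb a η β (-(firstDiff η β) - M).toNat M t := if_neg h

theorem ballProb_nonneg (ha : IsJumpRate a) {t : ℝ} (ht : 0 ≤ t) (η β : TreeSpace B q) (M : ℤ) :
    0 ≤ ballProb a t η β M := by
  by_cases h : η ∈ ball β M
  · rw [ballProb_of_mem h]
    exact stayProb_nonneg ha η M ht
  · rw [ballProb_of_notMem h, jumpProb]
    refine mul_nonneg (mul_nonneg (mul_nonneg (inv_nonneg.2 (bigB_nonneg _ _ _))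
      (inv_nonneg.2 (branch_real_pos _ _).le)) ?_) (sub_nonneg.2 (decay_le_stayProb ha η _ ht))
    linarith [two_le_branch_real η (-(M + (-(firstDiff η β) - M).toNat + 1))]

/-- The transition probabilities into a ball and into the next larger ball differ by an
eigenfunction. -/
theorem ballProb_eq (ha : IsJumpRate a) {t : ℝ} (ht : 0 ≤ t) (η β : TreeSpace B q) (M : ℤ) :
    ballProb a t η β M = (β.branch (-(M + 2)) : ℝ)⁻¹ *
      (ballProb a t η β (M + 1) - decay a β M t * (ball β (M + 1)).indicator 1 η) +
      decay a β M t * (ball β M).indicator 1 η := by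
  by_cases h : η ∈ ball β M
  · have h' := ball_mono β (show M ≤ M + 1 by omega) h
    rw [ballProb_of_mem h, ballProb_of_mem h', Set.indicator_of_mem h, Set.indicator_of_mem h',
      stayProb_eq ha η M ht, decay_congr h', branch_eq_of_mem_ball h (by omega)]
    simp
  rw [Set.indicator_of_notMem h, ballProb_of_notMem h]
  have hlt : ¬ (-M ≤ firstDiff η β) := fun hle =>
    h (mem_ball_iff.2 fun i hi => seq_eq_of_lt_firstDiff (by omega))
  by_cases h' : η ∈ ball β (M + 1)
  -- Here `η` and `β` lie in different children of one ball, so `k = 1`.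
  · have hne : η ≠ β := fun hc => h (hc ▸ mem_ball_self _ _)
    have h1 := le_firstDiff hne (mem_ball_iff.1 h')
    rw [ballProb_of_mem h', Set.indicator_of_mem h',
      show (-(firstDiff η β) - M).toNat = 1 by omega, jumpProb, bigB_one]
    have hb := two_le_branch_real β (-(M + 2))
    have hb' : (β.branch (-(M + 2)) : ℝ) - 1 ≠ 0 := by linarith
    have hb'' := branch_real_ne_zero β (-(M + 2))
    have e : M + ((1 : ℕ) : ℤ) + 1 = M + 2 := by push_cast; ring
    rw [e, branch_eq_of_mem_ball h' (by omega)]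
    simp only [Nat.cast_one, add_sub_cancel_right, Pi.one_apply, decay_congr h']
    field_simp
    ring
  -- Both levels are jumps with the same `M + k`; only the factor `B(β, k, M)` changes, by one
  -- branching number.
  · have h1 : ¬ (-(M + 1) ≤ firstDiff η β) := fun hle =>
      h' (mem_ball_iff.2 fun i hi => seq_eq_of_lt_firstDiff (by omega))
    rw [ballProb_of_notMem h', Set.indicator_of_notMem h']
    obtain ⟨m, hm⟩ : ∃ m : ℕ, (-(firstDiff η β) - (M + 1)).toNat = m := ⟨_, rfl⟩
    rw [hm, show (-(firstDiff η β) - M).toNat = m + 1 by omega, jumpProb, jumpProb,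
      bigB_succ β (by omega)]
    push_cast
    rw [show M + ((m : ℤ) + 1) = M + 1 + m by ring, mul_inv]
    ring

/-- To prove a statement on all levels it suffices to do so for large balls, and to descend. -/
theorem ball_induction {η β : TreeSpace B q} {p : ℤ → Prop} (h0 : ∀ M, η ∈ ball β M → p M)
    (h1 : ∀ M, p (M + 1) → p M) (M : ℤ) : p M := by
  obtain ⟨k, hk⟩ := exists_mem_ball β η M
  induction k generalizing M with
  | zero => exact h0 M (by simpa using hk)
  | succ k ih => exact h1 M (ih (M + 1) (by
      rwa [show M + 1 + (k : ℤ) = M + ((k + 1 : ℕ) : ℤ) by push_cast; ring]))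

theorem mem_ball_congr {η η' β β' : TreeSpace B q} {M N : ℤ} (hη : η' ∈ ball η M)
    (hβ : β' ∈ ball β M) (hMN : M ≤ N) : η' ∈ ball β' N ↔ η ∈ ball β N := by
  rw [ball_eq_of_mem (ball_mono β hMN hβ), mem_ball_comm, mem_ball_comm (α := β),
    ball_eq_of_mem (ball_mono η hMN hη)]

theorem indicator_ball_congr {η η' β β' : TreeSpace B q} {M N : ℤ} (hη : η' ∈ ball η M)
    (hβ : β' ∈ ball β M) (hMN : M ≤ N) :
    (ball β' N).indicator (1 : TreeSpace B q → ℝ) η' = (ball β N).indicator 1 η := by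
  by_cases h : η ∈ ball β N
  · rw [Set.indicator_of_mem h, Set.indicator_of_mem ((mem_ball_congr hη hβ hMN).2 h)]
    rfl
  · rw [Set.indicator_of_notMem h,
      Set.indicator_of_notMem (mt (mem_ball_congr hη hβ hMN).1 h)]

/-- The recursion reduces this to balls containing both points, where only `stayProb` occurs. -/
theorem ballProb_congr (ha : IsJumpRate a) {t : ℝ} (ht : 0 ≤ t) {η η' β β' : TreeSpace B q}
    {M : ℤ} (hη : η' ∈ ball η M) (hβ : β' ∈ ball β M) :
    ballProb a t η' β' M = ballProb a t η β M := by
  revert hη hβ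
  refine ball_induction (η := η) (β := β) (p := fun M => η' ∈ ball η M → β' ∈ ball β M →
    ballProb a t η' β' M = ballProb a t η β M) ?_ ?_ M
  · intro M h hη hβ
    rw [ballProb_of_mem h, ballProb_of_mem ((mem_ball_congr hη hβ le_rfl).2 h),
      stayProb_congr hη]
  · intro M ih hη hβ
    have hle : M ≤ M + 1 := by omega
    rw [ballProb_eq ha ht η', ballProb_eq ha ht η,
      ih (ball_mono _ hle hη) (ball_mono _ hle hβ), indicator_ball_congr hη hβ le_rfl,
      indicator_ball_congr hη hβ hle, decay_congr (ball_mono _ hle hβ),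
      branch_eq_of_mem_ball hβ (by omega)]

theorem sum_indicator_child (η β : TreeSpace B q) (M : ℤ) :
    ∑ j, (ball (child β M j) (M - 1)).indicator (1 : TreeSpace B q → ℝ) η =
      (ball β M).indicator 1 η := by
  by_cases h : η ∈ ball β M
  · obtain ⟨j, hj⟩ := exists_mem_ball_child h
    have h0 : ∀ i ∈ Finset.univ, i ≠ j →
        (ball (child β M i) (M - 1)).indicator (1 : TreeSpace B q → ℝ) η = 0 := fun i _ hij =>
      Set.indicator_of_notMem (fun hi => hij (Fin.ext
        ((mem_ball_child_iff.1 hi).2.symm.trans (mem_ball_child_iff.1 hj).2))) _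
    rw [Finset.sum_eq_single_of_mem j (Finset.mem_univ j) h0, Set.indicator_of_mem h,
      Set.indicator_of_mem hj]
  · rw [Set.indicator_of_notMem h]
    exact Finset.sum_eq_zero fun j _ =>
      Set.indicator_of_notMem (fun hj => h (mem_ball_child_iff.1 hj).1) _

/-- In the recursion for each of the `b` children the factor `b⁻¹` is compensated by their number,
and the indicators of the children add up to that of the ball, so the terms with `E` cancel. -/
theorem sum_ballProb_child (ha : IsJumpRate a) {t : ℝ} (ht : 0 ≤ t) (η β : TreeSpace B q)
    (M : ℤ) : ∑ j, ballProb a t η (child β M j) (M - 1) = ballProb a t η β M := by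
  have h : ∀ j, ballProb a t η (child β M j) (M - 1) = (β.branch (-(M + 1)) : ℝ)⁻¹ *
      (ballProb a t η β M - decay a β (M - 1) t * (ball β M).indicator 1 η) +
      decay a β (M - 1) t * (ball (child β M j) (M - 1)).indicator 1 η := by
    intro j
    have hj := child_mem_ball β j
    rw [ballProb_eq ha ht, sub_add_cancel, ballProb_congr ha ht (mem_ball_self η M) hj,
      indicator_ball_congr (mem_ball_self η M) hj le_rfl,
      decay_congr (by rwa [sub_add_cancel]), show M - 1 + 2 = M + 1 by ring,
      branch_eq_of_mem_ball hj (by omega)]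
  simp only [h]
  rw [Finset.sum_add_distrib, ← Finset.mul_sum, ← Finset.mul_sum, sum_indicator_child, Finset.sum_const,
    Finset.card_univ, Fintype.card_fin, nsmul_eq_mul, ← mul_assoc,
    inv_mul_cancel₀ (branch_real_ne_zero _ _)]
  ring

/-! ### The transition measures -/

theorem isBallContent_ballProb (ha : IsJumpRate a) {t : ℝ} (ht : 0 ≤ t) (η : TreeSpace B q) :
    IsBallContent fun β M => ENNReal.ofReal (ballProb a t η β M) where
  congr h := by rw [ballProb_congr ha ht (mem_ball_self η _) h]
  sum_child β M := by
    rw [← sum_ballProb_child ha ht, ENNReal.ofReal_sum_of_nonneg fun j _ =>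
      ballProb_nonneg ha ht _ _ _]

theorem transition_ball (ha : IsJumpRate a) {t : ℝ} (ht : 0 ≤ t) (η β : TreeSpace B q) (M : ℤ) :
    transition a η t (ball β M) = ENNReal.ofReal (ballProb a t η β M) :=
  (isBallContent_ballProb ha ht η).measureOfBalls_ball β M

/-- On growing balls around `η` the mass lies between `exp(-a(n) t)` and 1, and `a(n) → 0`. -/
theorem transition_univ (ha : IsJumpRate a) {t : ℝ} (ht : 0 ≤ t) (η : TreeSpace B q) :
    transition a η t Set.univ = 1 := by
  have h1 := tendsto_measure_iUnion_atTop (μ := transition a η t)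
    (s := fun n : ℕ => ball η n) fun m n hmn => ball_mono η (by exact_mod_cast hmn)
  rw [iUnion_ball] at h1
  refine tendsto_nhds_unique h1 ?_
  have h2 : Tendsto (fun n : ℕ => stayProb a η n t) atTop (𝓝 1) := by
    refine tendsto_of_tendsto_of_tendsto_of_le_of_le ?_ tendsto_const_nhds
      (fun n => exp_le_stayProb ha η n ht) fun n => stayProb_le_one ha η n ht
    have := ((ha.tendsto_zero.comp tendsto_natCast_atTop_atTop).neg.mul_const t).rexp
    simpa using this
  have h3 := ENNReal.tendsto_ofReal h2
  rw [ENNReal.ofReal_one] at h3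
  refine h3.congr fun n => ?_
  rw [Function.comp_apply, transition_ball ha ht, ballProb_of_mem (mem_ball_self _ _)]

theorem measurable_ballProb (ha : IsJumpRate a) {t : ℝ} (ht : 0 ≤ t) (β : TreeSpace B q)
    (M : ℤ) : Measurable fun η => ballProb a t η β M := by
  refine Continuous.measurable (IsLocallyConstant.continuous ?_)
  rw [IsLocallyConstant.iff_eventually_eq]
  intro η
  filter_upwards [(isOpen_ball η M).mem_nhds (mem_ball_self η M)] with η' hη'
  exact ballProb_congr ha ht hη' (mem_ball_self β M)

theorem measurable_transition (ha : IsJumpRate a) {t : ℝ} (ht : 0 ≤ t) :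
    Measurable fun η : TreeSpace B q => transition a η t := by
  have : ∀ η : TreeSpace B q, IsProbabilityMeasure (transition a η t) := fun η =>
    ⟨transition_univ ha ht η⟩
  refine Measurable.measure_of_isPiSystem_of_isProbabilityMeasure borel_eq_generateFrom_ball
    isPiSystem_ball ?_
  rintro _ ⟨β, M, rfl⟩
  simp only [transition_ball ha ht]
  exact (measurable_ballProb ha ht β M).ennreal_ofReal

theorem eq_transition (ha : IsJumpRate a) {t : ℝ} (ht : 0 ≤ t) {η : TreeSpace B q}
    {ν : Measure (TreeSpace B q)}
    (h : ∀ β N, ν (ball β N) = ENNReal.ofReal (ballProb a t η β N)) :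
    ν = transition a η t :=
  measure_ext_of_ball (fun β N => by rw [h, transition_ball ha ht])
    fun β N => by rw [h]; exact ENNReal.ofReal_ne_top


end TreeSpace

/-! ### Symmetry and the semigroup property -/

namespace TreeSpace

open ProbabilityTheory

variable {B : Branching} {q : ℝ} [Fact (1 < q)] {a : ℤ → ℝ}

/-- Detailed balance on balls of equal radius. -/
theorem ballProb_mul_ballMass_comm (ha : IsJumpRate a) {t : ℝ} (ht : 0 ≤ t)
    (η β : TreeSpace B q) (M : ℤ) :
    ballProb a t η β M * (ballMass η M).toReal = ballProb a t β η M * (ballMass β M).toReal := by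
  refine ball_induction (η := η) (β := β) (p := fun M => ballProb a t η β M *
    (ballMass η M).toReal = ballProb a t β η M * (ballMass β M).toReal) ?_ ?_ M
  · intro M h
    rw [ballProb_of_mem h, ballProb_of_mem (mem_ball_comm.1 h), stayProb_congr h,
      ballMass_congr h]
  · intro M ih
    by_cases h : η ∈ ball β M
    · rw [ballProb_of_mem h, ballProb_of_mem (mem_ball_comm.1 h), stayProb_congr h,
        ballMass_congr h]
    have hmass : ∀ α : TreeSpace B q, (ballMass α (M + 1)).toReal =
        α.branch (-(M + 2)) * (ballMass α M).toReal := fun α => by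
      rw [ballMass_eq_branch_mul, ENNReal.toReal_mul, ENNReal.toReal_natCast,
        add_sub_cancel_right, show M + 1 + 1 = M + 2 by ring]
    have hη := branch_real_ne_zero η (-(M + 2))
    have hβ := branch_real_ne_zero β (-(M + 2))
    rw [hmass, hmass] at ih
    rw [ballProb_eq ha ht η β, ballProb_eq ha ht β η, Set.indicator_of_notMem h,
      Set.indicator_of_notMem (mt mem_ball_comm.1 h)]
    by_cases h' : η ∈ ball β (M + 1)
    · have hm := ballMass_congr h'
      have hb : η.branch (-(M + 2)) = β.branch (-(M + 2)) := branch_eq_of_mem_ball h' (by omega)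
      have hm' : (ballMass η M).toReal = (ballMass β M).toReal := by
        have := congrArg ENNReal.toReal hm
        rw [hmass, hmass, hb] at this
        exact mul_left_cancel₀ hβ this
      rw [ballProb_of_mem h', ballProb_of_mem (mem_ball_comm.1 h'), stayProb_congr h',
        Set.indicator_of_mem h', Set.indicator_of_mem (mem_ball_comm.1 h'), decay_congr h', hb,
        hm']
      rfl
    -- Both indicators vanish at both levels: each probability loses the branching number at its
    -- target and each mass the one at its source, the same two factors on either side.
    · rw [Set.indicator_of_notMem h', Set.indicator_of_notMem (mt mem_ball_comm.1 h')]
      field_simp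
      linear_combination ih

/-- The transition function as a Markov kernel. -/
noncomputable def transitionKernel (ha : IsJumpRate a) {t : ℝ} (ht : 0 ≤ t) :
    Kernel (TreeSpace B q) (TreeSpace B q) :=
  ⟨fun η => transition a η t, measurable_transition ha ht⟩

theorem transitionKernel_apply (ha : IsJumpRate a) {t : ℝ} (ht : 0 ≤ t) (η : TreeSpace B q) :
    transitionKernel ha ht η = transition a η t := rfl

instance (ha : IsJumpRate a) {t : ℝ} (ht : 0 ≤ t) :
    IsMarkovKernel (transitionKernel (B := B) (q := q) ha ht) :=
  ⟨fun η => ⟨transition_univ ha ht η⟩⟩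

theorem ballProb_le_one (ha : IsJumpRate a) {t : ℝ} (ht : 0 ≤ t) (η β : TreeSpace B q) (M : ℤ) :
    ballProb a t η β M ≤ 1 := by
  rw [← ENNReal.ofReal_le_one, ← transition_ball ha ht, ← transition_univ ha ht η]
  exact measure_mono (Set.subset_univ _)

theorem compProd_prod_ball (ha : IsJumpRate a) {t : ℝ} (ht : 0 ≤ t) (α β : TreeSpace B q)
    (N : ℤ) : (mu B q ⊗ₘ transitionKernel ha ht) (ball α N ×ˢ ball β N) =
      ENNReal.ofReal (ballProb a t α β N) * ballMass α N := by
  rw [Measure.compProd_apply_prod (measurableSet_ball α N) (measurableSet_ball β N),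
    setLIntegral_congr_fun (g := fun _ => ENNReal.ofReal (ballProb a t α β N))
      (measurableSet_ball α N), setLIntegral_const, mu_ball]
  intro η hη
  change transition a η t _ = _
  rw [transition_ball ha ht, ballProb_congr ha ht hη (mem_ball_self β N)]

/-- On products of balls of equal radius this is detailed balance, and such products determine the
measure. -/
theorem map_swap_compProd (ha : IsJumpRate a) {t : ℝ} (ht : 0 ≤ t) :
    (mu B q ⊗ₘ transitionKernel ha ht).map Prod.swap = mu B q ⊗ₘ transitionKernel ha ht := by
  symm
  refine measure_ext_of_prod_ball (fun α β N => ?_) fun α β N => ?_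
  · rw [Measure.map_apply measurable_swap
      ((measurableSet_ball α N).prod (measurableSet_ball β N)), Set.preimage_swap_prod,
      compProd_prod_ball, compProd_prod_ball, ← ENNReal.ofReal_toReal (ballMass_ne_top α N),
      ← ENNReal.ofReal_toReal (ballMass_ne_top β N),
      ← ENNReal.ofReal_mul (ballProb_nonneg ha ht _ _ _),
      ← ENNReal.ofReal_mul (ballProb_nonneg ha ht _ _ _), ballProb_mul_ballMass_comm ha ht]
  · rw [compProd_prod_ball]
    exact ENNReal.mul_ne_top ENNReal.ofReal_ne_top (ballMass_ne_top α N)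

theorem lintegral_transition_symm (ha : IsJumpRate a) {t : ℝ} (ht : 0 ≤ t)
    {u v : TreeSpace B q → ℝ≥0∞} (hu : Measurable u) (hv : Measurable v) :
    ∫⁻ η, u η * (∫⁻ ξ, v ξ ∂(transition a η t)) ∂(mu B q) =
      ∫⁻ ξ, (∫⁻ η, u η ∂(transition a ξ t)) * v ξ ∂(mu B q) := by
  have h : ∀ f g : TreeSpace B q → ℝ≥0∞, Measurable f → Measurable g →
      ∫⁻ η, f η * (∫⁻ ξ, g ξ ∂(transition a η t)) ∂(mu B q) =
        ∫⁻ p, f p.1 * g p.2 ∂(mu B q ⊗ₘ transitionKernel ha ht) := by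
    intro f g hf hg
    rw [Measure.lintegral_compProd (by fun_prop)]
    exact lintegral_congr fun η => (lintegral_const_mul _ hg).symm
  simp only [mul_comm _ (v _)]
  rw [h u v hu hv, h v u hv hu]
  conv_rhs => rw [← map_swap_compProd ha ht]
  rw [lintegral_map (by fun_prop) measurable_swap]
  simp only [Prod.fst_swap, Prod.snd_swap, mul_comm]

theorem integrable_ballProb (ha : IsJumpRate a) {s : ℝ} (hs : 0 ≤ s) (β : TreeSpace B q) (M : ℤ)
    (ν : Measure (TreeSpace B q)) [IsFiniteMeasure ν] :
    Integrable (fun ξ => ballProb a s ξ β M) ν := by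
  refine Integrable.of_bound (measurable_ballProb ha hs β M).aestronglyMeasurable 1
    (ae_of_all _ fun ξ => ?_)
  rw [Real.norm_of_nonneg (ballProb_nonneg ha hs _ _ _)]
  exact ballProb_le_one ha hs _ _ _

/-- The Chapman-Kolmogorov equation on balls. -/
theorem integral_ballProb (ha : IsJumpRate a) {s t : ℝ} (hs : 0 ≤ s) (ht : 0 ≤ t)
    (η β : TreeSpace B q) (M : ℤ) :
    ∫ ξ, ballProb a s ξ β M ∂(transition a η t) = ballProb a (t + s) η β M := by
  have hst : 0 ≤ t + s := add_nonneg ht hs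
  have : IsProbabilityMeasure (transition a η t) := ⟨transition_univ ha ht η⟩
  have hind : ∀ M : ℤ, Integrable ((ball β M).indicator (1 : TreeSpace B q → ℝ))
      (transition a η t) := fun M =>
    (integrable_const (1 : ℝ)).indicator (measurableSet_ball β M)
  have hint : ∀ M : ℤ, ∫ ξ, (ball β M).indicator (1 : TreeSpace B q → ℝ) ξ ∂(transition a η t) =
      ballProb a t η β M := fun M => by
    rw [integral_indicator_one (measurableSet_ball β M), Measure.real, transition_ball ha ht,
      ENNReal.toReal_ofReal (ballProb_nonneg ha ht _ _ _)]
  let D : ℤ → ℝ := fun M =>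
    ∫ ξ, ballProb a s ξ β M ∂(transition a η t) - ballProb a (t + s) η β M
  -- Integrating the recursion at time `s` and inserting the one at time `t` gives the inhomogeneity
  -- `E(s) E(t) (1_M - b⁻¹ 1_{M+1})`, that of the recursion at time `t + s`; it cancels in the
  -- difference.
  have hD : ∀ M : ℤ, D M = (β.branch (-(M + 2)) : ℝ)⁻¹ * D (M + 1) := by
    intro M
    have h1 : ∫ ξ, ballProb a s ξ β M ∂(transition a η t) = (β.branch (-(M + 2)) : ℝ)⁻¹ *
        (∫ ξ, ballProb a s ξ β (M + 1) ∂(transition a η t) -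
          decay a β M s * ballProb a t η β (M + 1)) + decay a β M s * ballProb a t η β M := by
      have hi := integrable_ballProb ha hs β (M + 1) (transition a η t)
      have hi' : Integrable (fun ξ => (β.branch (-(M + 2)) : ℝ)⁻¹ * (ballProb a s ξ β (M + 1) -
          decay a β M s * (ball β (M + 1)).indicator 1 ξ)) (transition a η t) :=
        (hi.sub ((hind _).const_mul _)).const_mul _
      rw [← hint M, ← hint (M + 1), ← integral_const_mul, ← integral_const_mul,
        ← integral_sub hi ((hind _).const_mul _), ← integral_const_mul,
        ← integral_add hi' ((hind _).const_mul _)]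
      exact integral_congr_ae (ae_of_all _ fun ξ => ballProb_eq ha hs ξ β M)
    simp only [D]
    rw [h1, ballProb_eq ha ht η β M, ballProb_eq ha hst η β M, decay_add]
    ring
  have hle : ∀ M : ℤ, |D M| ≤ 1 := by
    intro M
    have h1 : 0 ≤ ∫ ξ, ballProb a s ξ β M ∂(transition a η t) :=
      integral_nonneg fun ξ => ballProb_nonneg ha hs _ _ _
    have h2 : ∫ ξ, ballProb a s ξ β M ∂(transition a η t) ≤ 1 := by
      refine (integral_mono (integrable_ballProb ha hs β M _) (integrable_const (1 : ℝ))
        fun ξ => ballProb_le_one ha hs _ _ _).trans_eq (by simp)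
    have h3 := ballProb_nonneg ha hst η β M
    have h4 := ballProb_le_one ha hst η β M
    exact abs_le.2 ⟨by simp only [D]; linarith, by simp only [D]; linarith⟩
  -- Each level climbed gains a factor `b⁻¹ ≤ 1/2`, while the bound 1 holds at all levels.
  have hpow : ∀ (n : ℕ) (M : ℤ), |D M| ≤ (1 / 2) ^ n := by
    intro n
    induction n with
    | zero => simpa using hle
    | succ n ih =>
      intro M
      rw [hD, abs_mul, abs_of_pos (inv_pos.2 (branch_real_pos _ _)), pow_succ', one_div]
      exact mul_le_mul (inv_anti₀ two_pos (two_le_branch_real _ _)) (by simpa using ih (M + 1))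
        (abs_nonneg _) (by norm_num)
  have h0 : |D M| ≤ 0 := ge_of_tendsto'
    (tendsto_pow_atTop_nhds_zero_of_lt_one (by norm_num) (by norm_num)) fun n => hpow n M
  exact sub_eq_zero.1 (abs_nonpos_iff.1 h0)

theorem transitionKernel_comp (ha : IsJumpRate a) {s t : ℝ} (hs : 0 ≤ s) (ht : 0 ≤ t)
    (η : TreeSpace B q) : (transitionKernel ha hs ∘ₖ transitionKernel ha ht) η =
      transition a η (t + s) := by
  refine eq_transition ha (add_nonneg ht hs) fun β N => ?_
  have : IsProbabilityMeasure (transition a η t) := ⟨transition_univ ha ht η⟩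
  rw [Kernel.comp_apply' _ _ _ (measurableSet_ball β N), ← integral_ballProb ha hs ht,
    ofReal_integral_eq_lintegral_ofReal (integrable_ballProb ha hs β N _)
      (ae_of_all _ fun ξ => ballProb_nonneg ha hs _ _ _)]
  simp only [transitionKernel_apply, transition_ball ha hs]

theorem semigroupOp_semigroupOp (ha : IsJumpRate a) {s t : ℝ} (hs : 0 ≤ s) (ht : 0 ≤ t)
    {u : TreeSpace B q → ℝ} (hu : Measurable u) (hbd : ∃ C : ℝ, ∀ ξ, |u ξ| ≤ C)
    (η : TreeSpace B q) :
    semigroupOp a t (semigroupOp a s u) η = semigroupOp a (t + s) u η := by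
  obtain ⟨C, hC⟩ := hbd
  rw [semigroupOp, semigroupOp, ← transitionKernel_comp ha hs ht, Kernel.integral_comp]
  · rfl
  · exact Integrable.of_bound hu.aestronglyMeasurable C (ae_of_all _ hC)

end TreeSpace

open TreeSpace in
theorem proposition4p1 (B : Branching) (q : ℝ) [Fact (1 < q)]
    (a : ℤ → ℝ) (W : EReal)
    (ha_anti : ∀ N : ℤ, a (N + 1) ≤ a N)
    (ha_top : Tendsto a atTop (𝓝 0))
    (hW : 0 < W)
    (ha_bot : Tendsto (fun N : ℤ => (a N : EReal)) atBot (𝓝 W)) :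
    -- `μ` has the prescribed values on balls, and is the only such Borel measure
    (mu B q (ball 0 0) = 1 ∧
      (∀ (α : TreeSpace B q) (M : ℤ),
        mu B q (ball α M) = (α.branch (-(M + 1)) : ℝ≥0∞) * mu B q (ball α (M - 1))) ∧
      (∀ ν : Measure (TreeSpace B q), ν (ball 0 0) = 1 →
        (∀ (α : TreeSpace B q) (M : ℤ),
          ν (ball α M) = (α.branch (-(M + 1)) : ℝ≥0∞) * ν (ball α (M - 1))) →
        ν = mu B q)) ∧
    -- `P(η, ·, t)` has the prescribed values on balls, and is the only such Borel measure
    (∀ (t : ℝ), 0 < t → ∀ η : TreeSpace B q,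
      (∀ (β : TreeSpace B q) (N : ℤ), 0 ≤ ballProb a t η β N ∧
        transition a η t (ball β N) = ENNReal.ofReal (ballProb a t η β N)) ∧
      (∀ ν : Measure (TreeSpace B q),
        (∀ (β : TreeSpace B q) (N : ℤ), ν (ball β N) = ENNReal.ofReal (ballProb a t η β N)) →
        ν = transition a η t)) ∧
    -- `P(·, ·, t)` is a kernel
    (∀ (t : ℝ), 0 < t → ∀ A : Set (TreeSpace B q), MeasurableSet A →
      Measurable fun η : TreeSpace B q => transition a η t A) ∧
    -- (i) symmetry
    (∀ (t : ℝ), 0 < t → ∀ u v : TreeSpace B q → ℝ≥0∞, Measurable u → Measurable v →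
      ∫⁻ η, u η * (∫⁻ ξ, v ξ ∂(transition a η t)) ∂(mu B q) =
        ∫⁻ ξ, (∫⁻ η, u η ∂(transition a ξ t)) * v ξ ∂(mu B q)) ∧
    -- (ii) conservativeness
    (∀ (t : ℝ), 0 < t → ∀ η : TreeSpace B q, transition a η t Set.univ = 1) ∧
    -- (iii) semigroup property
    (∀ (s t : ℝ), 0 < s → 0 < t → ∀ u : TreeSpace B q → ℝ, Measurable u →
      (∃ C : ℝ, ∀ ξ, |u ξ| ≤ C) → ∀ η : TreeSpace B q,
      semigroupOp a t (semigroupOp a s u) η = semigroupOp a (t + s) u η) := by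
  have ha : IsJumpRate a := ⟨ha_anti, ha_top⟩
  refine ⟨⟨?_, fun α M => ?_, fun ν h1 h => eq_mu h1 h⟩,
    fun t ht η => ⟨fun β N => ⟨ballProb_nonneg ha ht.le η β N, transition_ball ha ht.le η β N⟩,
      fun ν h => eq_transition ha ht.le h⟩,
    fun t ht A hA => (Measure.measurable_coe hA).comp (measurable_transition ha ht.le),
    fun t ht u v hu hv => lintegral_transition_symm ha ht.le hu hv,
    fun t ht η => transition_univ ha ht.le η,
    fun s t hs ht u hu hbd η => semigroupOp_semigroupOp ha hs.le ht.le hu hbd η⟩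
  · rw [mu_ball, ballMass_zero]
  · rw [mu_ball, mu_ball, ballMass_eq_branch_mul]
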